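/- For a graph $G$ with vertex set $\{1,\dots,4\}$ let $\mathcal S(G)$ be the set of real symmetric $4\times 4$ matrices $A=[a_{ij}]$ such that, for $i\ne j$, $a_{ij}\neq 0$ if and only if $ij$ is an edge of $G$ (the diagonal is unrestricted). If $\lambda_1<\dots<\lambda_k$ are the distinct eigenvalues of $A$, with multiplicities $m_1,\dots,m_k$, then $(m_1,\dots,m_k)$ is the ordered multiplicity list of $A$. A symmetric matrix $A$ has the Strong Spectral Property (SSP) if $X=O$ is the only symmetric matrix with $A\circ X=O$, $I\circ X=O$ and $AX=XA$, where $\circ$ is the entrywise product. The graph $G$ attains a list (with the SSP) if some $A\in\mathcal S(G)$ (with the SSP) has that ordered multiplicity list. A list $(m_1,\dots,m_k)$ is spectrally arbitrary for $G$ with the SSP if for all real numbers $\lambda_1<\dots<\lambda_k$ there is a matrix $A\in\mathcal S(G)$ with the SSP whose distinct eigenvalues are $\lambda_1,\dots,\lambda_k$, with multiplicities $m_1,\dots,m_k$. A graph is minimal for a list if it attains the list with the SSP and no proper subgraph on the same vertex set does. Write $K_n$, $C_n$, $P_n$, $K_{1,3}$ for the complete graph, cycle, path and claw, $\dot\cup$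 for disjoint union, $4K_1$ for the graph of order 4 without edges, Paw for a triangle with a pendant edge, and Diamond for $K_4$ with one edge deleted. 1. Up to isomorphism, the minimal graphs for the ordered multiplicity lists of order 4 are exactly the following: - for $(3,1)$ and $(1,3)$: $K_4$; - for $(2,2)$: $C_4$; - for $(1,2,1)$: $C_4$, $K_3\mathbin{\dot\cup}K_1$ and $K_{1,3}$; - for $(2,1,1)$ and $(1,1,2)$: $C_4$ and $K_3\mathbin{\dot\cup}K_1$; - for $(1,1,1,1)$: $4K_1$; - for $(4)$: none. 2. Every connected graph of order 4 is isomorphic to one of the following six graphs, and the ordered multiplicity lists that it attains (with or without the SSP) are exactly those given: - $P_4$: $(1,1,1,1)$; - $K_{1,3}$: $(1,1,1,1)$, $(1,2,1)$; - Paw: $(1,1,1,1)$, $(1,2,1)$, $(2,1,1)$, $(1,1,2)$; - $C_4$ and Diamond: $(1,1,1,1)$, $(1,2,1)$, $(2,1,1)$, $(1,1,2)$, $(2,2)$; - $K_4$: $(1,1,1,1)$, $(1,2,1)$, $(2,1,1)$, $(1,1,2)$, $(2,2)$, $(3,1)$, $(1,3)$. Moreover, for every connected graph of order 4, each ordered multiplicity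 list that the graph attains is spectrally arbitrary for it with the SSP. -/

import Mathlib

open scoped Matrix

namespace IEP

noncomputable section

variable {V : Type*} [Fintype V] [DecidableEq V]

/-- The set `S(G)` of real symmetric matrices described by the graph `G`: the off-diagonal entry
`A i j` is nonzero exactly when `i` and `j` are adjacent; the diagonal is unrestricted. -/
def describedBy (G : SimpleGraph V) : Set (Matrix V V ℝ) :=
  {A | A.IsSymm ∧ ∀ i j, i ≠ j → (A i j ≠ 0 ↔ G.Adj i j)}

/-- The Strong Spectral Property, for a symmetric matrix `A`. -/
def HasSSP (A : Matrix V V ℝ) : Prop :=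
  ∀ X : Matrix V V ℝ, X.IsSymm → A ⊙ X = 0 → (1 : Matrix V V ℝ) ⊙ X = 0 → A * X = X * A → X = 0

/-- The multiplicity of `μ` as an eigenvalue of `A` (it is `0` if `μ` is not an eigenvalue). -/
def mult (A : Matrix V V ℝ) (μ : ℝ) : ℕ := A.charpoly.rootMultiplicity μ

/-- The finite set of distinct (real) eigenvalues of `A`. -/
def eigenvalueSet (A : Matrix V V ℝ) : Finset ℝ := A.charpoly.roots.toFinset

/-- The ordered multiplicity list of `A`: the multiplicities of the distinct eigenvalues, with the
eigenvalues taken in increasing order. -/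
def oml (A : Matrix V V ℝ) : List ℕ := ((eigenvalueSet A).sort (· ≤ ·)).map (mult A)

/-- The ordered multiplicity lists attained by `G`. -/
def attainedLists (G : SimpleGraph V) : Set (List ℕ) :=
  {m | ∃ A ∈ describedBy G, oml A = m}

/-- `G` attains the ordered multiplicity list `m` with the SSP. -/
def AttainsWithSSP (m : List ℕ) (G : SimpleGraph V) : Prop :=
  ∃ A ∈ describedBy G, HasSSP A ∧ oml A = m

/-- `G` is a minimal graph for `m` with respect to the SSP: it attains `m` with the SSP and no
proper subgraph of `G` on the same vertex set does. -/
def IsMinimalForSSP (m : List ℕ) (G : SimpleGraph V) : Prop :=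
  Minimal (AttainsWithSSP m) G

/-- The list `m = (m₁, …, m_k)` is spectrally arbitrary for `G` with the SSP: for all reals
`lam₁ < ⋯ < lam_k` there is a matrix in `S(G)` with the SSP whose distinct eigenvalues are
`lam₁, …, lam_k` with multiplicities `m₁, …, m_k`. -/
def SpectrallyArbitraryWithSSP (m : List ℕ) (G : SimpleGraph V) : Prop :=
  ∀ lam : Fin m.length → ℝ, StrictMono lam →
    ∃ A ∈ describedBy G, HasSSP A ∧
      eigenvalueSet A = Finset.univ.image lam ∧ ∀ i, mult A (lam i) = m.get i

end

/-- The paw: a triangle with a pendant edge. -/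
def paw : SimpleGraph (Fin 4) :=
  SimpleGraph.fromEdgeSet {s(0, 1), s(1, 2), s(0, 2), s(2, 3)}

/-- The diamond: `K₄` with one edge deleted. -/
def diamond : SimpleGraph (Fin 4) :=
  (⊤ : SimpleGraph (Fin 4)).deleteEdges {s(0, 1)}

/-- The claw `K_{1,3}`. -/
abbrev K13 : SimpleGraph (Fin 1 ⊕ Fin 3) := completeBipartiteGraph (Fin 1) (Fin 3)

/-- The disjoint union of `K₃` and `K₁`. -/
abbrev K3K1 : SimpleGraph (Fin 3 ⊕ Fin 1) := (⊤ : SimpleGraph (Fin 3)) ⊕g (⊤ : SimpleGraph (Fin 1))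

/-- The two graphs are isomorphic. -/
def Iso {V W : Type*} (G : SimpleGraph V) (H : SimpleGraph W) : Prop := Nonempty (G ≃g H)

end IEP

/-! The proof rests on the supergraph lemma `exists_charpoly_eq_of_le`: a matrix with the SSP can be
moved into `S(H)`, for any supergraph `H` on the same vertices, with spectrum and SSP intact. Look
for a skew `K` and a matrix `B`, equal to `A` plus a perturbation on the diagonal and the edges of
`G` plus `ε` times the indicator of the new edges, with `(1 + K) A (1 - K) = (1 - K) B (1 + K)`.
Then `B` is the conjugate of `A` by a Cayley transform. The SSP makes the linearization at `0`
surjective (`tangentMap_surjective`), so a solution exists for some `ε ≠ 0`. Attainment and spectral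
arbitrariness with the SSP therefore pass to supergraphs, and explicit matrices are needed only for
five graphs: the empty graph, the triangle with an isolated vertex, the claw, the 4-cycle and the
complete graph.

The obstructions hold with or without the SSP. An eigenspace of dimension `d` contains a nonzero
vector vanishing at any `d - 1` chosen positions. Hence an edge excludes multiplicity 4, an induced
path on three vertices excludes 3, and the path `P_4` excludes 2. A symmetric matrix with at most
two eigenvalues satisfies `(A - a)(A - b) = 0`, which is impossible when two nonadjacent vertices
have exactly one common neighbour; this excludes `(2, 2)` for the claw and the paw. In the claw a
double eigenvalue is a diagonal entry at a leaf, so it can be neither the least nor the greatest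
eigenvalue.

Constructions and obstructions match. For each list, every graph on four vertices either contains
one of the claimed minimal graphs or embeds in a graph that cannot attain the list. These
dichotomies and the list of connected graphs are finite checks over the 64 labelled graphs. -/

namespace IEP

/-! ### Stability of the SSP and surjectivity of the linearization -/

section Supergraph

open Filter Topology

set_option linter.unusedSectionVars false

variable {V : Type*} [Fintype V] [DecidableEq V]

attribute [local instance] Matrix.linftyOpNormedRing Matrix.linftyOpNormedAlgebra
  Matrix.linftyOpNormedAddCommGroup Matrix.linftyOpNormedSpace

/-- The linear conditions in the SSP still force `X = 0` after a small perturbation of the matrix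
in the commutation relation. -/
theorem HasSSP.eventually {A : Matrix V V ℝ} (hA : HasSSP A) :
    ∀ᶠ M in 𝓝 A, ∀ X : Matrix V V ℝ, X.IsSymm → A ⊙ X = 0 → (1 : Matrix V V ℝ) ⊙ X = 0 →
      M * X = X * M → X = 0 := by
  have : ProperSpace (Matrix V V ℝ) := FiniteDimensional.proper_real _
  have hcomp : IsCompact (Metric.sphere (0 : Matrix V V ℝ) 1) := isCompact_sphere _ _
  have hcl : IsClosed {X : Matrix V V ℝ | X.IsSymm ∧ A ⊙ X = 0 ∧ (1 : Matrix V V ℝ) ⊙ X = 0} := by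
    refine IsClosed.inter ?_ (IsClosed.inter ?_ ?_)
    · exact isClosed_eq (by fun_prop) continuous_id
    · refine isClosed_eq ?_ continuous_const
      exact continuous_matrix fun i j => by
        simp only [Matrix.hadamard_apply]; fun_prop
    · refine isClosed_eq ?_ continuous_const
      exact continuous_matrix fun i j => by
        simp only [Matrix.hadamard_apply]; fun_prop
  -- The conditions on `X` are homogeneous, so unit vectors suffice. There noncommutation is an open
  -- condition, and compactness of the sphere makes it uniform for `M` near `A`.
  have key := (hcomp.inter_right hcl).eventually_forall_of_forall_eventually (x₀ := A)
    (P := fun M X => M * X ≠ X * M) (by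
      rintro X ⟨hX1, hX⟩
      have hne : A * X ≠ X * A := fun h => by
        have := hA X hX.1 hX.2.1 hX.2.2 h
        simp [this] at hX1
      have hc : Continuous fun z : Matrix V V ℝ × Matrix V V ℝ => z.1 * z.2 - z.2 * z.1 := by
        fun_prop
      have := hc.continuousAt.eventually_ne (x := (A, X)) (y := 0) (sub_ne_zero.2 hne)
      filter_upwards [this] with z hz
      exact sub_ne_zero.1 hz)
  filter_upwards [key] with M hM X h1 h2 h3 h4
  by_contra hX
  have hn : ‖X‖ ≠ 0 := norm_ne_zero_iff.2 hX
  refine hM (‖X‖⁻¹ • X) ⟨?_, ?_, ?_, ?_⟩ ?_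
  · simp [norm_smul, hn]
  · exact h1.smul _
  · rw [Matrix.hadamard_smul, h2, smul_zero]
  · rw [Matrix.hadamard_smul, h3, smul_zero]
  · simp [h4]

/-- The matrix keeping the entries of `M + Mᵀ` on the diagonal and on the edges of `G`. -/
noncomputable def symMask (G : SimpleGraph V) : Matrix V V ℝ →ₗ[ℝ] Matrix V V ℝ where
  toFun M := open Classical in
    Matrix.of fun i j => if i = j ∨ G.Adj i j then M i j + M j i else 0
  map_add' M N := by
    ext i j; simp only [Matrix.of_apply, Matrix.add_apply]; split_ifs <;> ring
  map_smul' r M := by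
    ext i j; simp only [Matrix.of_apply, Matrix.smul_apply, smul_eq_mul, RingHom.id_apply]
    split_ifs <;> ring

/-- `M - Mᵀ` as a linear map. -/
def skewMap : Matrix V V ℝ →ₗ[ℝ] Matrix V V ℝ :=
  LinearMap.id - (Matrix.transposeLinearEquiv V V ℝ ℝ).toLinearMap

@[simp] theorem skewMap_apply (M : Matrix V V ℝ) : skewMap M = M - Mᵀ := rfl

/-- The linearization of the isospectral deformation problem. -/
noncomputable def tangentMap (G : SimpleGraph V) (A : Matrix V V ℝ) :
    Matrix V V ℝ × Matrix V V ℝ × Matrix V V ℝ →ₗ[ℝ] Matrix V V ℝ :=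
  (2 : ℝ) • ((LinearMap.mulRight ℝ A - LinearMap.mulLeft ℝ A) ∘ₗ skewMap).coprod
    (0 : Matrix V V ℝ × Matrix V V ℝ →ₗ[ℝ] Matrix V V ℝ)
  + LinearMap.coprod 0 ((-symMask G).coprod skewMap)

theorem tangentMap_apply (G : SimpleGraph V) (A K M S : Matrix V V ℝ) :
    tangentMap G A (K, M, S) =
      (2 : ℝ) • ((K - Kᵀ) * A - A * (K - Kᵀ)) - symMask G M + (S - Sᵀ) := by
  simp [tangentMap]; abel

/-- Duality: a functional vanishing on the range is the trace pairing with a matrix `X`. The skew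
slack forces `X` to be symmetric, the mask kills its diagonal and its entries on edges, and the
commutators force it to commute with `A`. These are the hypotheses of the SSP, so `X = 0`. -/
theorem tangentMap_surjective {G : SimpleGraph V} {A : Matrix V V ℝ} (hA : A ∈ describedBy G)
    (hS : HasSSP A) : LinearMap.range (tangentMap G A) = ⊤ := by
  by_contra hne
  obtain ⟨f, hf0, hf⟩ := Submodule.exists_le_ker_of_lt_top _ (lt_top_iff_ne_top.2 hne)
  have hf' (K M S) : f (tangentMap G A (K, M, S)) = 0 := hf ⟨_, rfl⟩
  set X : Matrix V V ℝ := Matrix.of fun i j => f (Matrix.single i j 1) with hX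
  have hfX (Y : Matrix V V ℝ) : f Y = (Xᵀ * Y).trace := by
    conv_lhs => rw [Matrix.matrix_eq_sum_single Y]
    simp only [map_sum, Matrix.trace, Matrix.diag, Matrix.mul_apply, Matrix.transpose_apply]
    rw [Finset.sum_comm]
    refine Finset.sum_congr rfl fun j _ => Finset.sum_congr rfl fun i _ => ?_
    have : Matrix.single i j (Y i j) = Y i j • Matrix.single i j (1 : ℝ) := by simp
    rw [this, map_smul, hX]
    simp [mul_comm]
  have hXs : X.IsSymm := by
    ext i j
    have := hf' 0 0 (Matrix.single i j 1)
    simp only [tangentMap_apply, Matrix.transpose_single, map_zero, Matrix.transpose_zero, sub_zero,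
      zero_mul, mul_zero, smul_zero, zero_add, map_sub] at this
    simp only [hX, Matrix.transpose_apply, Matrix.of_apply]
    linarith
  have hmask (M) : f (symMask G M) = 0 := by
    have := hf' 0 M 0
    simpa [tangentMap_apply] using this
  have hz (i j) (hij : i = j ∨ G.Adj i j) : X i j = 0 := by
    have h1 := hmask (Matrix.single i j 1)
    have h2 : symMask G (Matrix.single i j 1) = Matrix.single i j (1 : ℝ) + Matrix.single j i 1 := by
      ext a b
      simp only [symMask, LinearMap.coe_mk, AddHom.coe_mk, Matrix.of_apply, Matrix.add_apply,
        Matrix.single_apply]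
      by_cases hab : a = b ∨ G.Adj a b
      · simp only [hab, if_true]
        grind
      · simp only [hab, if_false]
        have h3 : ¬ (i = a ∧ j = b) := by rintro ⟨rfl, rfl⟩; exact hab hij
        have h4 : ¬ (j = a ∧ i = b) := by
          rintro ⟨rfl, rfl⟩; exact hab (hij.imp Eq.symm fun h => h.symm)
        simp [h3, h4]
    rw [h2, map_add] at h1
    have h3 : X i j = X j i := (congrFun (congrFun hXs j) i)
    have h4 : X i j + X j i = 0 := h1
    linarith
  have hcomm : A * X = X * A := by
    set C := A * X - X * A with hC
    have hAs : Aᵀ = A := hA.1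
    have hCt : Cᵀ = -C := by
      simp [hC, Matrix.transpose_mul, hXs.eq, hAs]
    -- Testing in the direction of the commutator `C` itself yields, up to a factor, the trace of `C
    -- * C`. Since `C` is skew, this is minus its squared Frobenius norm.
    have h1 := hf' C 0 0
    simp only [tangentMap_apply, map_zero, Matrix.transpose_zero, sub_zero, add_zero, hCt, hfX,
      hXs.eq] at h1
    have h2 : (Cᵀ * C).trace = 0 := by
      have e : X * ((2 : ℝ) • ((C - -C) * A - A * (C - -C)))
          = (4 : ℝ) • (X * C * A - X * A * C) := by
        have e1 : C - -C = (2 : ℝ) • C := by rw [two_smul]; abel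
        rw [e1]
        simp only [Matrix.smul_mul, Matrix.mul_smul, ← smul_sub, smul_smul, mul_sub]
        norm_num [mul_assoc]
      rw [e, Matrix.trace_smul, Matrix.trace_sub, Matrix.trace_mul_comm (X * C) A,
        ← mul_assoc, ← Matrix.trace_sub, ← sub_mul, ← hC] at h1
      rw [hCt, neg_mul, Matrix.trace_neg]
      simpa using h1
    have h3 : C = 0 := by
      have := Matrix.trace_conjTranspose_mul_self_eq_zero_iff (A := C)
      rw [Matrix.conjTranspose_eq_transpose_of_trivial] at this
      exact this.1 h2
    exact sub_eq_zero.1 h3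
  have hX0 : X = 0 := by
    refine hS X hXs ?_ ?_ hcomm
    · ext i j
      by_cases hij : i = j ∨ G.Adj i j
      · simp [hz i j hij]
      · push Not at hij
        have : A i j = 0 := by
          by_contra h
          exact hij.2 ((hA.2 i j hij.1).1 h)
        simp [this]
    · ext i j
      by_cases hij : i = j
      · simp [hz i j (Or.inl hij)]
      · simp [hij]
  exact hf0 (LinearMap.ext fun Y => by simp [hfX, hX0])

end Supergraph
-- Isospectral deformation into a supergraph
section Supergraph

open Filter Topology

set_option linter.unusedSectionVars false

variable {V : Type*} [Fintype V] [DecidableEq V]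

attribute [local instance] Matrix.linftyOpNormedRing Matrix.linftyOpNormedAlgebra
  Matrix.linftyOpNormedAddCommGroup Matrix.linftyOpNormedSpace

theorem symMask_isSymm (G : SimpleGraph V) (M : Matrix V V ℝ) : (symMask G M).IsSymm := by
  have h (i j) : (j = i ∨ G.Adj j i) ↔ (i = j ∨ G.Adj i j) := by
    rw [G.adj_comm j i, eq_comm (a := j) (b := i)]
  ext i j
  simp only [symMask, LinearMap.coe_mk, AddHom.coe_mk, Matrix.transpose_apply, Matrix.of_apply,
    add_comm (M j i)]
  by_cases h1 : i = j ∨ G.Adj i j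
  · rw [if_pos h1, if_pos ((h i j).2 h1)]
  · rw [if_neg h1, if_neg fun h2 => h1 ((h i j).1 h2)]

theorem symMask_apply_eq_zero {G : SimpleGraph V} (M : Matrix V V ℝ) {i j : V} (hij : i ≠ j)
    (h : ¬ G.Adj i j) : symMask G M i j = 0 := by
  simp [symMask, hij, h]

/-- The defect of the equation `B = Q * A * Q⁻¹`, where `B = A + b + ε • E` and `Q` is the Cayley
transform of the skew-symmetric matrix `K - Kᵀ`, relaxed by a skew-symmetric slack. -/
noncomputable def cayleyDefect (G : SimpleGraph V) (A E : Matrix V V ℝ)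
    (p : (Matrix V V ℝ × Matrix V V ℝ × Matrix V V ℝ) × ℝ) : Matrix V V ℝ :=
  (1 + skewMap p.1.1) * A * (1 - skewMap p.1.1)
    - (1 - skewMap p.1.1) * (A + symMask G p.1.2.1 + p.2 • E) * (1 + skewMap p.1.1)
    + skewMap p.1.2.2

/-- The coordinate `ε` is kept as a second output so that surjectivity of the derivative allows `ε`
to be prescribed. The factor 2 in `tangentMap` arises because both Cayley products contribute the
same commutator. -/
theorem hasStrictFDerivAt_cayleyDefect (G : SimpleGraph V) (A E : Matrix V V ℝ) :
    HasStrictFDerivAt (fun p => (cayleyDefect G A E p, p.2))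
      (LinearMap.toContinuousLinearMap
        (((tangentMap G A).coprod (-(LinearMap.toSpanSingleton ℝ (Matrix V V ℝ) E))).prod
          (LinearMap.snd ℝ _ ℝ))) 0 := by
  have lin (L : (Matrix V V ℝ × Matrix V V ℝ × Matrix V V ℝ) × ℝ →ₗ[ℝ] Matrix V V ℝ) :
      HasStrictFDerivAt (fun p => L p) (LinearMap.toContinuousLinearMap L) 0 :=
    (LinearMap.toContinuousLinearMap L).hasStrictFDerivAt
  have hk := lin (skewMap ∘ₗ LinearMap.fst ℝ _ _ ∘ₗ LinearMap.fst ℝ _ _)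
  have hb := lin (symMask G ∘ₗ LinearMap.fst ℝ _ _ ∘ₗ LinearMap.snd ℝ _ _ ∘ₗ LinearMap.fst ℝ _ _)
  have hs := lin (skewMap ∘ₗ LinearMap.snd ℝ _ _ ∘ₗ LinearMap.snd ℝ _ _ ∘ₗ LinearMap.fst ℝ _ _)
  have he := lin (LinearMap.toSpanSingleton ℝ _ E ∘ₗ LinearMap.snd ℝ _ _)
  have h2 : HasStrictFDerivAt
      (fun p : (Matrix V V ℝ × Matrix V V ℝ × Matrix V V ℝ) × ℝ => p.2)
      (ContinuousLinearMap.snd ℝ _ _) 0 := hasStrictFDerivAt_snd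
  have h1 := (((hk.const_add 1).mul' (hasStrictFDerivAt_const A 0)).mul' (hk.const_sub 1)).sub
    (((hk.const_sub 1).mul' (((hasStrictFDerivAt_const A 0).add hb).add he)).mul' (hk.const_add 1))
    |>.add hs
  refine (h1.prodMk h2).congr_fderiv ?_
  refine ContinuousLinearMap.ext fun p => ?_
  obtain ⟨⟨K, M, S⟩, ε⟩ := p
  refine Prod.ext ?_ rfl
  change (1 + skewMap 0) * A * -(skewMap K) + ((1 + skewMap 0) * 0 + skewMap K * A) * (1 - skewMap 0)
    - ((1 - skewMap 0) * (A + symMask G 0 + (0 : ℝ) • E) * skewMap K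
      + ((1 - skewMap 0) * (0 + symMask G M + ε • E)
        + -skewMap K * (A + symMask G 0 + (0 : ℝ) • E)) * (1 + skewMap 0)) + skewMap S
    = tangentMap G A (K, M, S) + -(ε • E)
  rw [tangentMap_apply, map_zero, map_zero]
  simp only [skewMap_apply, two_smul, sub_zero, add_zero, zero_smul, mul_zero, one_mul, mul_one,
    zero_add, mul_neg, neg_mul]
  abel

/-- The factors `1 + K` and `1 - K` commute, so the relation exhibits `B` as the conjugate of `A` by
`(1 - K)⁻¹ (1 + K)`. -/
theorem charpoly_eq_of_cayley {A B K : Matrix V V ℝ}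
    (h : (1 + K) * A * (1 - K) = (1 - K) * B * (1 + K)) (h1 : (1 + K).det ≠ 0)
    (h2 : (1 - K).det ≠ 0) : B.charpoly = A.charpoly := by
  have hcm : Commute (1 + K) (1 - K) :=
    (Commute.one_left _).add_left ((Commute.one_right K).sub_right (Commute.refl K))
  obtain ⟨u, hu⟩ := (Matrix.isUnit_iff_isUnit_det _).2 (isUnit_iff_ne_zero.2 h1)
  obtain ⟨w, hw⟩ := (Matrix.isUnit_iff_isUnit_det _).2 (isUnit_iff_ne_zero.2 h2)
  rw [← hu, ← hw] at h hcm
  have hcu : Commute u w := Units.ext hcm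
  have hB : B = w⁻¹.val * (u.val * A * w.val) * u⁻¹.val := by
    rw [h]; simp only [mul_assoc, Units.mul_inv, Units.inv_mul_cancel_left, mul_one]
  have hcu' : w.val * u⁻¹.val = u⁻¹.val * w.val := by
    exact_mod_cast congrArg Units.val hcu.inv_left.eq.symm
  have hB' : B = (w⁻¹ * u).val * A * (w⁻¹ * u)⁻¹.val := by
    rw [hB, mul_inv_rev, inv_inv, Units.val_mul, Units.val_mul, ← hcu']
    simp only [mul_assoc]
  rw [hB', Matrix.coe_units_inv]
  exact Matrix.charpoly_units_conj _ _

/-- **Supergraph lemma.** A matrix with the SSP can be perturbed, keeping its spectrum and the SSP,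
to a matrix described by any given supergraph. -/
theorem exists_charpoly_eq_of_le {G H : SimpleGraph V} (hGH : G ≤ H) {A : Matrix V V ℝ}
    (hA : A ∈ describedBy G) (hS : HasSSP A) :
    ∃ B ∈ describedBy H, HasSSP B ∧ B.charpoly = A.charpoly := by
  classical
  set E : Matrix V V ℝ := Matrix.of fun i j => if H.Adj i j ∧ ¬ G.Adj i j then 1 else 0 with hE
  have hEs : E.IsSymm := by
    ext i j
    simp [hE, H.adj_comm j i, G.adj_comm j i]
  have hder := hasStrictFDerivAt_cayleyDefect G A E
  have hsurj : (LinearMap.range (LinearMap.toContinuousLinearMap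
        (((tangentMap G A).coprod (-(LinearMap.toSpanSingleton ℝ (Matrix V V ℝ) E))).prod
          (LinearMap.snd ℝ _ ℝ))).toLinearMap) = ⊤ := by
    rw [LinearMap.range_eq_top]
    rintro ⟨Y, η⟩
    obtain ⟨p, hp⟩ := LinearMap.range_eq_top.1 (tangentMap_surjective hA hS) (Y + η • E)
    exact ⟨(p, η), by simp [hp]⟩
  have hmap := hder.map_nhds_eq_of_surj hsurj
  have h00 : (cayleyDefect G A E 0, (0 : (Matrix V V ℝ × Matrix V V ℝ × Matrix V V ℝ) × ℝ).2)
      = (0, 0) := by simp [cayleyDefect]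
  rw [h00] at hmap
  let B : (Matrix V V ℝ × Matrix V V ℝ × Matrix V V ℝ) × ℝ → Matrix V V ℝ :=
    fun p => A + symMask G p.1.2.1 + p.2 • E
  have hmc : Continuous (symMask G) := (symMask G).continuous_of_finiteDimensional
  have hkc : Continuous (skewMap (V := V)) := skewMap.continuous_of_finiteDimensional
  have hBc : Continuous B := by fun_prop
  have hB0 : B 0 = A := by simp [B]
  have ev1 : ∀ᶠ p in 𝓝 (0 : (Matrix V V ℝ × Matrix V V ℝ × Matrix V V ℝ) × ℝ),
      ∀ X : Matrix V V ℝ, X.IsSymm → A ⊙ X = 0 → (1 : Matrix V V ℝ) ⊙ X = 0 →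
      B p * X = X * B p → X = 0 := by
    have h := hBc.tendsto 0
    rw [hB0] at h
    exact h.eventually hS.eventually
  have ev2 : ∀ᶠ p in 𝓝 (0 : (Matrix V V ℝ × Matrix V V ℝ × Matrix V V ℝ) × ℝ),
      ∀ i j, A i j ≠ 0 → B p i j ≠ 0 := by
    refine eventually_all.2 fun i => eventually_all.2 fun j => ?_
    by_cases h : A i j = 0
    · exact Eventually.of_forall fun _ h' => absurd h h'
    have hc : Continuous fun p => B p i j := hBc.matrix_elem i j
    filter_upwards [hc.continuousAt.eventually_ne (x := 0) (y := 0) (by rw [hB0]; exact h)]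
      with p hp _ using hp
  have ev3 : ∀ᶠ p in 𝓝 (0 : (Matrix V V ℝ × Matrix V V ℝ × Matrix V V ℝ) × ℝ),
      (1 + skewMap p.1.1).det ≠ 0 := by
    have hc : Continuous fun p : (Matrix V V ℝ × Matrix V V ℝ × Matrix V V ℝ) × ℝ =>
        (1 + skewMap p.1.1).det := Continuous.matrix_det (by fun_prop)
    exact hc.continuousAt.eventually_ne (by simp)
  have ev4 : ∀ᶠ p in 𝓝 (0 : (Matrix V V ℝ × Matrix V V ℝ × Matrix V V ℝ) × ℝ),
      (1 - skewMap p.1.1).det ≠ 0 := by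
    have hc : Continuous fun p : (Matrix V V ℝ × Matrix V V ℝ × Matrix V V ℝ) × ℝ =>
        (1 - skewMap p.1.1).det := Continuous.matrix_det (by fun_prop)
    exact hc.continuousAt.eventually_ne (by simp)
  have himg := image_mem_map (m := fun p => (cayleyDefect G A E p, p.2))
    ((ev1.and (ev2.and (ev3.and ev4))))
  have htend : Tendsto (fun ε : ℝ => ((0 : Matrix V V ℝ), ε)) (𝓝[≠] 0) (𝓝 (0, 0)) :=
    ((by fun_prop : Continuous fun ε : ℝ => ((0 : Matrix V V ℝ), ε)).tendsto 0).mono_left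
      nhdsWithin_le_nhds
  -- Local openness at `0`: for small `ε`, the pair `(0, ε)` is the image of a parameter meeting all
  -- four open conditions.
  have hev := htend.eventually (hmap.ge himg)
  obtain ⟨ε, ⟨p, ⟨hp1, hp2, hp3, hp4⟩, hp⟩, hε⟩ :=
    (hev.and (self_mem_nhdsWithin : ∀ᶠ ε in 𝓝[≠] (0 : ℝ), ε ≠ 0)).exists
  have hpe : p.2 = ε := congrArg Prod.snd hp
  have hp0 : cayleyDefect G A E p = 0 := congrArg Prod.fst hp
  have hAs : Aᵀ = A := hA.1
  have hBs : (B p)ᵀ = B p := by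
    simp only [B, Matrix.transpose_add, hAs, (symMask_isSymm G _).eq, Matrix.transpose_smul, hEs.eq]
  have hBA (i j) (hij : i ≠ j) (h : ¬ G.Adj i j) : B p i j = ε * E i j := by
    have hAz : A i j = 0 := by
      by_contra h'
      exact h ((hA.2 i j hij).1 h')
    simp [B, hAz, symMask_apply_eq_zero _ hij h, hpe]
  refine ⟨B p, ⟨hBs, fun i j hij => ?_⟩, fun X hX h1 h2 h3 => hp1 X hX ?_ h2 h3, ?_⟩
  · by_cases hG : G.Adj i j
    · exact iff_of_true (hp2 i j ((hA.2 i j hij).2 hG)) (hGH hG)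
    · rw [hBA i j hij hG]
      by_cases hH : H.Adj i j
      · simpa [hE, hG, hH] using hε
      · simp [hE, hH]
  -- Every nonzero entry of `A` stays nonzero in `B p`, so `B p ⊙ X = 0` implies the condition `A ⊙
  -- X = 0` used in the perturbed SSP.
  · ext i j
    have h4 : B p i j * X i j = 0 := congrFun (congrFun h1 i) j
    rcases mul_eq_zero.1 h4 with h | h
    · have : A i j = 0 := by
        by_contra h'
        exact hp2 i j h' h
      simp [this]
    · simp [h]
  · set K := skewMap p.1.1 with hK
    have hKt : Kᵀ = -K := by simp [hK]
    set S := skewMap p.1.2.2 with hSd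
    have hSt : Sᵀ = -S := by simp [hSd]
    have heq : (1 + K) * A * (1 - K) - (1 - K) * B p * (1 + K) + S = 0 := hp0
    have heqt := congrArg Matrix.transpose heq
    simp only [Matrix.transpose_add, Matrix.transpose_sub, Matrix.transpose_mul, hKt, hSt, hAs, hBs,
      Matrix.transpose_one, Matrix.transpose_zero, sub_neg_eq_add, ← sub_eq_add_neg,
      ← mul_assoc] at heqt
    -- The two Cayley products are symmetric and `S` is skew, so adding the transposed equation
    -- eliminates the slack.
    have hmain : (1 + K) * A * (1 - K) = (1 - K) * B p * (1 + K) := by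
      have h5 : (2 : ℝ) • ((1 + K) * A * (1 - K) - (1 - K) * B p * (1 + K)) = 0 := by
        calc _ = ((1 + K) * A * (1 - K) - (1 - K) * B p * (1 + K) + S)
              + ((1 + K) * A * (1 - K) - (1 - K) * B p * (1 + K) - S) := by rw [two_smul]; abel
          _ = 0 := by rw [heq, heqt, add_zero]
      exact sub_eq_zero.1 ((smul_eq_zero.1 h5).resolve_left two_ne_zero)
    exact charpoly_eq_of_cayley hmain hp3 hp4

end Supergraph
-- Spectra, multiplicity lists and their monotonicity
section Spectral

open Polynomial

set_option linter.unusedSectionVars false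

variable {V : Type*} [Fintype V] [DecidableEq V] {W : Type*} [Fintype W] [DecidableEq W]

theorem eigenvalueSet_congr {A : Matrix V V ℝ} {B : Matrix W W ℝ} (h : A.charpoly = B.charpoly) :
    eigenvalueSet A = eigenvalueSet B := by
  rw [eigenvalueSet, eigenvalueSet, h]

theorem mult_congr {A : Matrix V V ℝ} {B : Matrix W W ℝ} (h : A.charpoly = B.charpoly) : mult A = mult B := by
  funext μ; rw [mult, mult, h]

theorem oml_congr {A : Matrix V V ℝ} {B : Matrix W W ℝ} (h : A.charpoly = B.charpoly) : oml A = oml B := by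
  rw [oml, oml, eigenvalueSet_congr h, mult_congr h]

theorem AttainsWithSSP.mono {m : List ℕ} {G H : SimpleGraph V} (hGH : G ≤ H)
    (h : AttainsWithSSP m G) : AttainsWithSSP m H := by
  obtain ⟨A, hA, hS, hm⟩ := h
  obtain ⟨B, hB, hBS, hc⟩ := exists_charpoly_eq_of_le hGH hA hS
  exact ⟨B, hB, hBS, (oml_congr hc).trans hm⟩

theorem SpectrallyArbitraryWithSSP.mono {m : List ℕ} {G H : SimpleGraph V} (hGH : G ≤ H)
    (h : SpectrallyArbitraryWithSSP m G) : SpectrallyArbitraryWithSSP m H := fun lam hlam => by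
  obtain ⟨A, hA, hS, he, hm⟩ := h lam hlam
  obtain ⟨B, hB, hBS, hc⟩ := exists_charpoly_eq_of_le hGH hA hS
  exact ⟨B, hB, hBS, (eigenvalueSet_congr hc).trans he, fun i => by rw [mult_congr hc, hm]⟩

theorem SpectrallyArbitraryWithSSP.attainsWithSSP {m : List ℕ} {G : SimpleGraph V}
    (h : SpectrallyArbitraryWithSSP m G) : AttainsWithSSP m G := by
  -- Any increasing eigenvalues would do; `0, 1, 2, …` are chosen.
  have hmono : StrictMono fun i : Fin m.length => ((i : ℕ) : ℝ) :=
    Nat.strictMono_cast.comp Fin.val_strictMono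
  obtain ⟨A, hA, hS, he, hm⟩ := h _ hmono
  refine ⟨A, hA, hS, ?_⟩
  have hsort : (eigenvalueSet A).sort (· ≤ ·) =
      List.ofFn fun i : Fin m.length => ((i : ℕ) : ℝ) := by
    have hset : eigenvalueSet A = (List.ofFn fun i : Fin m.length => ((i : ℕ) : ℝ)).toFinset := by
      rw [he]; ext x; simp [List.mem_ofFn]
    rw [hset, List.toFinset_sort _ (List.nodup_ofFn.2 hmono.injective)]
    exact (hmono.monotone.sortedLE_ofFn).pairwise
  rw [oml, hsort, List.map_ofFn]
  conv_rhs => rw [← List.ofFn_get m]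
  exact congrArg List.ofFn (funext hm)

theorem AttainsWithSSP.mem_attainedLists {m : List ℕ} {G : SimpleGraph V}
    (h : AttainsWithSSP m G) : m ∈ attainedLists G := by
  obtain ⟨A, hA, -, hm⟩ := h
  exact ⟨A, hA, hm⟩

/-- A matrix whose characteristic polynomial is the expected one has the expected spectrum. -/
theorem spectrum_of_charpoly_eq_prod {m : List ℕ} (hm : ∀ i, 0 < m.get i) {lam : Fin m.length → ℝ}
    (hlam : StrictMono lam) {A : Matrix V V ℝ}
    (hA : A.charpoly = ∏ i, (X - C (lam i)) ^ m.get i) :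
    eigenvalueSet A = Finset.univ.image lam ∧ ∀ i, mult A (lam i) = m.get i := by
  have hroots : A.charpoly.roots = ∑ i, m.get i • {lam i} := by
    rw [hA, Polynomial.roots_prod _ _
      (Finset.prod_ne_zero_iff.2 fun i _ => pow_ne_zero _ (X_sub_C_ne_zero _))]
    simp [Multiset.bind, Multiset.join, Finset.sum]
  have hmult (i) : mult A (lam i) = m.get i := by
    rw [mult, ← count_roots, hroots, Multiset.count_sum']
    simp [Multiset.count_singleton, hlam.injective.eq_iff]
  refine ⟨?_, hmult⟩
  ext x
  simp only [eigenvalueSet, hroots, Multiset.mem_toFinset, Multiset.mem_sum, Finset.mem_image,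
    Finset.mem_univ, true_and]
  refine exists_congr fun i => ?_
  rw [Multiset.mem_nsmul, Multiset.mem_singleton]
  simp only [ne_eq, (hm i).ne', not_false_eq_true, true_and]
  exact eq_comm

theorem spectrallyArbitraryWithSSP_of_charpoly {m : List ℕ} (hm : ∀ i, 0 < m.get i)
    {G : SimpleGraph V}
    (h : ∀ lam : Fin m.length → ℝ, StrictMono lam → ∃ A ∈ describedBy G, HasSSP A ∧
      A.charpoly = ∏ i, (X - C (lam i)) ^ m.get i) : SpectrallyArbitraryWithSSP m G :=
  fun lam hlam => by
  obtain ⟨A, hA, hS, hc⟩ := h lam hlam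
  exact ⟨A, hA, hS, spectrum_of_charpoly_eq_prod hm hlam hc⟩

/-! ### Invariance under graph isomorphism -/

section Transport

variable {G : SimpleGraph V} {H : SimpleGraph W}

theorem reindex_mem_describedBy (e : G ≃g H) {A : Matrix V V ℝ} (hA : A ∈ describedBy G) :
    Matrix.reindex e.toEquiv e.toEquiv A ∈ describedBy H := by
  refine ⟨hA.1.submatrix _, fun i j hij => ?_⟩
  rw [Matrix.reindex_apply, Matrix.submatrix_apply,
    hA.2 _ _ (e.toEquiv.symm.injective.ne hij)]
  exact e.symm.map_adj_iff

theorem HasSSP.reindex (e : V ≃ W) {A : Matrix V V ℝ} (hA : HasSSP A) :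
    HasSSP (Matrix.reindex e e A) := by
  intro X hX h1 h2 h3
  have key : X.submatrix e e = 0 := by
    refine hA _ (hX.submatrix _) ?_ ?_ ?_
    · ext i j
      simpa using congrFun (congrFun h1 (e i)) (e j)
    · ext i j
      have := congrFun (congrFun h2 (e i)) (e j)
      simpa [Matrix.one_apply] using this
    · have h4 := congrArg (fun M => M.submatrix e e) h3
      simp only [Matrix.reindex_apply] at h4
      rw [← Matrix.submatrix_mul_equiv _ _ e e e, ← Matrix.submatrix_mul_equiv _ _ e e e] at h4
      simpa using h4
  ext i j
  simpa using congrFun (congrFun key (e.symm i)) (e.symm j)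

theorem attainedLists_subset_of_iso (e : G ≃g H) : attainedLists G ⊆ attainedLists H := by
  rintro m ⟨A, hA, hm⟩
  exact ⟨_, reindex_mem_describedBy e hA, (oml_congr (Matrix.charpoly_reindex _ _)).trans hm⟩

theorem attainedLists_eq_of_iso (e : G ≃g H) : attainedLists G = attainedLists H :=
  (attainedLists_subset_of_iso e).antisymm (attainedLists_subset_of_iso e.symm)

theorem AttainsWithSSP.of_iso (e : G ≃g H) {m : List ℕ} (h : AttainsWithSSP m G) :
    AttainsWithSSP m H := by
  obtain ⟨A, hA, hS, hm⟩ := h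
  exact ⟨_, reindex_mem_describedBy e hA, hS.reindex _,
    (oml_congr (Matrix.charpoly_reindex _ _)).trans hm⟩

theorem SpectrallyArbitraryWithSSP.of_iso (e : G ≃g H) {m : List ℕ}
    (h : SpectrallyArbitraryWithSSP m G) : SpectrallyArbitraryWithSSP m H := fun lam hlam => by
  obtain ⟨A, hA, hS, he, hm⟩ := h lam hlam
  have hc := Matrix.charpoly_reindex e.toEquiv A
  exact ⟨_, reindex_mem_describedBy e hA, hS.reindex _, (eigenvalueSet_congr hc).trans he,
    fun i => by rw [mult_congr hc, hm]⟩

end Transport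

/-! ### Eigenvectors of symmetric matrices -/

section Symmetric

variable {A : Matrix V V ℝ}

theorem isHermitian_of_isSymm (hA : A.IsSymm) : A.IsHermitian := by
  rw [Matrix.IsHermitian, Matrix.conjTranspose_eq_transpose_of_trivial]; exact hA

theorem mult_pos_iff {μ : ℝ} : 0 < mult A μ ↔ μ ∈ eigenvalueSet A := by
  rw [mult, eigenvalueSet, Multiset.mem_toFinset, ← count_roots, Multiset.count_pos]

theorem mem_oml {k : ℕ} : k ∈ oml A ↔ ∃ μ ∈ eigenvalueSet A, mult A μ = k := by
  simp [oml]

theorem pos_of_mem_oml {k : ℕ} (h : k ∈ oml A) : 0 < k := by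
  obtain ⟨μ, hμ, rfl⟩ := mem_oml.1 h
  exact mult_pos_iff.2 hμ

/-- Symmetry is needed because `eigenvalueSet` counts real roots only: it makes the characteristic
polynomial split over the reals. -/
theorem sum_oml (hA : A.IsSymm) : (oml A).sum = Fintype.card V := by
  have h1 : (oml A).sum = ∑ μ ∈ eigenvalueSet A, mult A μ := by
    rw [oml, Finset.sum, ← Finset.sort_eq (eigenvalueSet A) (· ≤ ·), Multiset.map_coe,
      Multiset.sum_coe]
  rw [h1]
  simp only [mult, eigenvalueSet, ← count_roots]
  rw [Multiset.toFinset_sum_count_eq]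
  rw [(isHermitian_of_isSymm hA).roots_charpoly_eq_eigenvalues]
  simp

theorem mem_eigenvalueSet_of_mulVec {μ : ℝ} {v : V → ℝ} (hv : v ≠ 0) (h : A *ᵥ v = μ • v) :
    μ ∈ eigenvalueSet A := by
  rw [eigenvalueSet, Multiset.mem_toFinset, mem_roots A.charpoly_monic.ne_zero, IsRoot.def,
    Matrix.eval_charpoly]
  refine Matrix.exists_mulVec_eq_zero_iff.1 ⟨v, hv, ?_⟩
  rw [Matrix.sub_mulVec, h, Matrix.scalar_apply, ← Matrix.smul_one_eq_diagonal, Matrix.smul_mulVec,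
    Matrix.one_mulVec, sub_self]

/-- An eigenspace of a symmetric matrix contains nonzero vectors vanishing at any given set of
fewer than `mult A μ` positions. -/
theorem exists_eigenvector_vanishing (hA : A.IsSymm) {μ : ℝ} (s : Finset V)
    (hs : s.card < mult A μ) : ∃ v : V → ℝ, v ≠ 0 ∧ A *ᵥ v = μ • v ∧ ∀ i ∈ s, v i = 0 := by
  have hH := isHermitian_of_isSymm hA
  let T := {j // hH.eigenvalues j = μ}
  have hT : Fintype.card T = mult A μ := by
    rw [mult, ← count_roots, hH.roots_charpoly_eq_eigenvalues, Multiset.count_map,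
      Fintype.card_subtype]
    simp only [eq_comm (a := μ)]
    rfl
  let b : V → V → ℝ := fun j => ⇑(hH.eigenvectorBasis j)
  -- `f` restricts a combination of the `μ`-eigenvectors to the positions in `s`. Its source has
  -- dimension `mult A μ`, larger than that of its target, so its kernel is nonzero.
  let f : (T → ℝ) →ₗ[ℝ] (s → ℝ) := LinearMap.pi fun i => ∑ j : T, b j i • LinearMap.proj j
  have hker : LinearMap.ker f ≠ ⊥ := by
    refine LinearMap.ker_ne_bot_of_finrank_lt ?_
    simpa [hT] using hs
  obtain ⟨c, hc, hc0⟩ := (Submodule.ne_bot_iff _).1 hker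
  have hlin : LinearIndependent ℝ (fun j : T => hH.eigenvectorBasis j) :=
    hH.eigenvectorBasis.orthonormal.linearIndependent.comp _ Subtype.val_injective
  refine ⟨∑ j : T, c j • b j, fun h0 => hc0 ?_, ?_, fun i hi => ?_⟩
  · funext j
    refine Fintype.linearIndependent_iff.1 hlin c ?_ j
    ext i
    simpa [b] using congrFun h0 i
  · rw [Matrix.mulVec_sum, Finset.smul_sum]
    refine Finset.sum_congr rfl fun j _ => ?_
    rw [Matrix.mulVec_smul, hH.mulVec_eigenvectorBasis, j.2, smul_comm]
  · have := congrFun (LinearMap.mem_ker.1 hc) ⟨i, hi⟩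
    simpa [f, mul_comm] using this

/-- A symmetric matrix with at most two eigenvalues satisfies a quadratic equation. -/
theorem sub_mul_sub_eq_zero (hA : A.IsSymm) {a b : ℝ} (h : ∀ μ ∈ eigenvalueSet A, μ = a ∨ μ = b) :
    (A - a • 1) * (A - b • 1) = 0 := by
  have hH := isHermitian_of_isSymm hA
  have hcol (j) : ((A - a • 1) * (A - b • 1)) *ᵥ ⇑(hH.eigenvectorBasis j) = 0 := by
    have hv := hH.mulVec_eigenvectorBasis j
    have hne : (⇑(hH.eigenvectorBasis j) : V → ℝ) ≠ 0 :=
      (WithLp.ofLp_eq_zero 2).ne.2 (hH.eigenvectorBasis.orthonormal.ne_zero j)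
    have hmem := mem_eigenvalueSet_of_mulVec hne hv
    have hsub (c : ℝ) : (A - c • 1) *ᵥ ⇑(hH.eigenvectorBasis j)
        = (hH.eigenvalues j - c) • ⇑(hH.eigenvectorBasis j) := by
      rw [Matrix.sub_mulVec, hv, Matrix.smul_mulVec, Matrix.one_mulVec, sub_smul]
    rw [← Matrix.mulVec_mulVec, hsub, Matrix.mulVec_smul, hsub, smul_smul]
    rcases h _ hmem with h | h <;> simp [h]
  have hU : ((A - a • 1) * (A - b • 1)) * (hH.eigenvectorUnitary : Matrix V V ℝ) = 0 := by
    ext i j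
    exact congrFun (hcol j) i
  calc (A - a • 1) * (A - b • 1) = ((A - a • 1) * (A - b • 1)) *
        ((hH.eigenvectorUnitary : Matrix V V ℝ) * star (hH.eigenvectorUnitary : Matrix V V ℝ)) := by
        rw [Matrix.mem_unitaryGroup_iff.1 hH.eigenvectorUnitary.2, mul_one]
    _ = 0 := by rw [← mul_assoc, hU, zero_mul]

/-- If a diagonal entry of a symmetric matrix is the smallest (`s = 1`) or the largest (`s = -1`)
eigenvalue, then the other entries in its row are zero. -/
theorem apply_eq_zero_of_extremal (hA : A.IsSymm) {s μ : ℝ} (hs : s * s = 1)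
    (h : ∀ ν ∈ eigenvalueSet A, 0 ≤ s * (ν - μ)) {i j : V} (hij : i ≠ j) (hi : A i i = μ) :
    A i j = 0 := by
  -- `B` is positive semidefinite with a zero at `(i, i)`, so its principal minor on `i, j` equals
  -- `-(A i j) ^ 2` and must be nonnegative.
  set B : Matrix V V ℝ := s • (A - μ • 1) with hB
  have hBs : B.IsSymm := (hA.sub (Matrix.isSymm_one.smul μ)).smul s
  have hH := isHermitian_of_isSymm hBs
  have hpsd : B.PosSemidef := by
    rw [hH.posSemidef_iff_eigenvalues_nonneg]
    intro k
    have hv := hH.mulVec_eigenvectorBasis k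
    have hne : (⇑(hH.eigenvectorBasis k) : V → ℝ) ≠ 0 :=
      (WithLp.ofLp_eq_zero 2).ne.2 (hH.eigenvectorBasis.orthonormal.ne_zero k)
    set v : V → ℝ := ⇑(hH.eigenvectorBasis k)
    set e := hH.eigenvalues k
    have hAv : A *ᵥ v = (μ + s * e) • v := by
      have h1 : s • (B *ᵥ v) = A *ᵥ v - μ • v := by
        rw [hB, Matrix.smul_mulVec, smul_smul, hs, one_smul, Matrix.sub_mulVec, Matrix.smul_mulVec,
          Matrix.one_mulVec]
      rw [add_smul, mul_smul, ← hv, h1]; abel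
    have h2 := h _ (mem_eigenvalueSet_of_mulVec hne hAv)
    have h3 : s * (μ + s * e - μ) = e := by linear_combination e * hs
    rwa [h3] at h2
  have hdet := (hpsd.submatrix ![i, j]).det_nonneg
  rw [Matrix.det_fin_two] at hdet
  have hs0 : s ≠ 0 := by rintro rfl; simp at hs
  have hji : A j i = A i j := congrFun (congrFun hA i) j
  simp [hB, hi, hij, hij.symm, hji] at hdet
  nlinarith [sq_nonneg (A i j), mul_self_nonneg (A i j)]

end Symmetric

end Spectral
-- Explicit matrices of order 4
section FinFour

open Polynomial

/-- The symmetric table with the given upper triangle. -/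
def table4 (a b c d e f : Bool) : Fin 4 → Fin 4 → Bool
  | 0, 1 | 1, 0 => a
  | 0, 2 | 2, 0 => b
  | 0, 3 | 3, 0 => c
  | 1, 2 | 2, 1 => d
  | 1, 3 | 3, 1 => e
  | 2, 3 | 3, 2 => f
  | _, _ => false

/-- The graph on four vertices with the edges `01`, `02`, `03`, `12`, `13`, `23` as indicated. -/
def graph4 (a b c d e f : Bool) : SimpleGraph (Fin 4) where
  Adj i j := table4 a b c d e f i j = true
  symm := ⟨by revert a b c d e f; decide⟩
  loopless := ⟨by revert a b c d e f; decide⟩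

instance (a b c d e f : Bool) : DecidableRel (graph4 a b c d e f).Adj :=
  fun _ _ => inferInstanceAs (Decidable (_ = true))

/-- The symmetric matrix with the given diagonal and upper triangle. -/
def sym4 (w x y z a b c d e f : ℝ) : Matrix (Fin 4) (Fin 4) ℝ :=
  !![w, a, b, c; a, x, d, e; b, d, y, f; c, e, f, z]

variable {w x y z a b c d e f : ℝ}

theorem sym4_isSymm : (sym4 w x y z a b c d e f).IsSymm := by
  ext i j; fin_cases i <;> fin_cases j <;> rfl

theorem sym4_mem_describedBy {a' b' c' d' e' f' : Bool} (ha : a ≠ 0 ↔ a' = true)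
    (hb : b ≠ 0 ↔ b' = true) (hc : c ≠ 0 ↔ c' = true) (hd : d ≠ 0 ↔ d' = true)
    (he : e ≠ 0 ↔ e' = true) (hf : f ≠ 0 ↔ f' = true) :
    sym4 w x y z a b c d e f ∈ describedBy (graph4 a' b' c' d' e' f') := by
  refine ⟨sym4_isSymm, fun i j hij => ?_⟩
  fin_cases i <;> fin_cases j <;> first | exact absurd rfl hij | assumption

theorem sym4_charpoly {p : ℝ[X]} (h : ∀ t, p.eval t =
    (t - w) * (t - x) * (t - y) * (t - z)
      - f ^ 2 * (t - w) * (t - x) - e ^ 2 * (t - w) * (t - y) - d ^ 2 * (t - w) * (t - z)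
      - c ^ 2 * (t - x) * (t - y) - b ^ 2 * (t - x) * (t - z) - a ^ 2 * (t - y) * (t - z)
      - 2 * d * e * f * (t - w) - 2 * b * c * f * (t - x) - 2 * a * c * e * (t - y)
      - 2 * a * b * d * (t - z) + a ^ 2 * f ^ 2 + b ^ 2 * e ^ 2 + c ^ 2 * d ^ 2
      - 2 * a * f * b * e - 2 * a * f * c * d - 2 * b * e * c * d) :
    (sym4 w x y z a b c d e f).charpoly = p := by
  refine Polynomial.funext fun t => ?_
  rw [h, Matrix.eval_charpoly, Matrix.scalar_apply]
  simp [sym4, Matrix.det_succ_row_zero, Fin.sum_univ_succ, Fin.succAbove]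
  ring

/-- The variables `p, q, r, s, t, u` are the entries `01, 02, 03, 12, 13, 23` of `X`. The commutator
of two symmetric matrices is skew, so its six entries above the diagonal carry the whole commutation
relation. -/
theorem sym4_hasSSP (h : ∀ p q r s t u : ℝ, a * p = 0 → b * q = 0 → c * r = 0 → d * s = 0 →
    e * t = 0 → f * u = 0 → w * p + b * s + c * t = p * x + q * d + r * e →
    w * q + a * s + c * u = p * d + q * y + r * f → w * r + a * t + b * u = p * e + q * f + r * z →
    a * q + x * s + e * u = p * b + s * y + t * f → a * r + x * t + d * u = p * c + s * f + t * z →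
    b * r + d * t + y * u = q * c + s * e + u * z →
    p = 0 ∧ q = 0 ∧ r = 0 ∧ s = 0 ∧ t = 0 ∧ u = 0) : HasSSP (sym4 w x y z a b c d e f) := by
  intro X hX h1 h2 h3
  have hs (i j) : X j i = X i j := congrFun (congrFun hX i) j
  have hd (i) : X i i = 0 := by simpa using congrFun (congrFun h2 i) i
  have hp (i j) : sym4 w x y z a b c d e f i j * X i j = 0 := congrFun (congrFun h1 i) j
  have hc (i j) := congrFun (congrFun h3 i) j
  simp only [Matrix.mul_apply, Fin.sum_univ_four] at hc
  have e01 := hc 0 1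
  have e02 := hc 0 2
  have e03 := hc 0 3
  have e12 := hc 1 2
  have e13 := hc 1 3
  have e23 := hc 2 3
  simp only [hd, hs 0 1, hs 0 2, hs 1 2, hs 1 3, hs 2 3, sym4, Matrix.of_apply,
    Matrix.cons_val', Matrix.cons_val, mul_zero, zero_mul, add_zero, zero_add]
    at e01 e02 e03 e12 e13 e23
  obtain ⟨h01, h02, h03, h12, h13, h23⟩ := h (X 0 1) (X 0 2) (X 0 3) (X 1 2) (X 1 3) (X 2 3)
    (hp 0 1) (hp 0 2) (hp 0 3) (hp 1 2) (hp 1 3) (hp 2 3) (by linarith) (by linarith)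
    (by linarith) (by linarith) (by linarith) (by linarith)
  ext i j
  fin_cases i <;> fin_cases j <;>
    simp [hd, hs 0 1, hs 0 2, hs 0 3, hs 1 2, hs 1 3, hs 2 3, h01, h02, h03, h12, h13, h23]

theorem exists_empty (x₀ x₁ x₂ x₃ : ℝ) (h01 : x₀ ≠ x₁) (h02 : x₀ ≠ x₂) (h03 : x₀ ≠ x₃)
    (h12 : x₁ ≠ x₂) (h13 : x₁ ≠ x₃) (h23 : x₂ ≠ x₃) :
    ∃ A ∈ describedBy (graph4 false false false false false false), HasSSP A ∧
      A.charpoly = (X - C x₀) * (X - C x₁) * (X - C x₂) * (X - C x₃) := by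
  refine ⟨sym4 x₀ x₁ x₂ x₃ 0 0 0 0 0 0, sym4_mem_describedBy (by simp) (by simp) (by simp)
    (by simp) (by simp) (by simp), sym4_hasSSP ?_, sym4_charpoly fun t => ?_⟩
  · intro p q r s t u _ _ _ _ _ _ e1 e2 e3 e4 e5 e6
    have key {α β v : ℝ} (hne : α ≠ β) (h : α * v = v * β) : v = 0 := by
      have : (α - β) * v = 0 := by linear_combination h
      exact (mul_eq_zero.1 this).resolve_left (sub_ne_zero.2 hne)
    exact ⟨key h01 (by linarith), key h02 (by linarith), key h03 (by linarith),
      key h12 (by linarith), key h13 (by linarith), key h23 (by linarith)⟩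
  · simp

/-- The matrix is `l I` plus a multiple of the all-ones matrix. The SSP is immediate because no
off-diagonal entry vanishes. -/
theorem exists_complete (l m : ℝ) (h : l ≠ m) :
    ∃ A ∈ describedBy (graph4 true true true true true true), HasSSP A ∧
      A.charpoly = (X - C l) ^ 3 * (X - C m) := by
  have h0 : (m - l) / 4 ≠ 0 := div_ne_zero (sub_ne_zero.2 h.symm) (by norm_num)
  refine ⟨sym4 (l + (m - l) / 4) (l + (m - l) / 4) (l + (m - l) / 4) (l + (m - l) / 4)
    ((m - l) / 4) ((m - l) / 4) ((m - l) / 4) ((m - l) / 4) ((m - l) / 4) ((m - l) / 4),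
    sym4_mem_describedBy (by simp [h0]) (by simp [h0]) (by simp [h0]) (by simp [h0])
      (by simp [h0]) (by simp [h0]), sym4_hasSSP ?_, sym4_charpoly fun t => ?_⟩
  · intro p q r s t u h1 h2 h3 h4 h5 h6 _ _ _ _ _ _
    exact ⟨(mul_eq_zero.1 h1).resolve_left h0, (mul_eq_zero.1 h2).resolve_left h0,
      (mul_eq_zero.1 h3).resolve_left h0, (mul_eq_zero.1 h4).resolve_left h0,
      (mul_eq_zero.1 h5).resolve_left h0, (mul_eq_zero.1 h6).resolve_left h0⟩
  · simp only [eval_mul, eval_pow, eval_sub, eval_X, eval_C]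
    ring

/-- The block `l I + k J` on the triangle, with `J` all ones, has eigenvalues `l, l, l + 3 k`; the
isolated vertex contributes `n`. The SSP holds because the free part of `X` would be an eigenvector
of the block for `n`, which is not one of its eigenvalues. -/
theorem exists_triangle (l m n : ℝ) (hlm : l ≠ m) (hln : l ≠ n) (hmn : m ≠ n) :
    ∃ A ∈ describedBy (graph4 true true false true false false), HasSSP A ∧
      A.charpoly = (X - C l) ^ 2 * (X - C m) * (X - C n) := by
  obtain ⟨k, hk⟩ : ∃ k, k = (m - l) / 3 := ⟨_, rfl⟩
  have hm : m = l + 3 * k := by rw [hk]; ring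
  subst hm
  have h0 : k ≠ 0 := by rintro rfl; simp at hlm
  refine ⟨sym4 (l + k) (l + k) (l + k) n k k 0 k 0 0,
    sym4_mem_describedBy (by simp [h0]) (by simp [h0]) (by simp) (by simp [h0])
      (by simp) (by simp), sym4_hasSSP ?_, sym4_charpoly fun t => ?_⟩
  · intro p q r s t u h1 h2 _ h4 _ _ _ _ e3 _ e5 e6
    have hp := (mul_eq_zero.1 h1).resolve_left h0
    have hq := (mul_eq_zero.1 h2).resolve_left h0
    have hs := (mul_eq_zero.1 h4).resolve_left h0
    subst hp hq hs
    have hsum : (l + 3 * k - n) * (r + t + u) = 0 := by linear_combination e3 + e5 + e6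
    have hsum := (mul_eq_zero.1 hsum).resolve_left (sub_ne_zero.2 hmn)
    have key {v : ℝ} (h : (l - n) * v = 0) : v = 0 :=
      (mul_eq_zero.1 h).resolve_left (sub_ne_zero.2 hln)
    exact ⟨rfl, rfl, key (by linear_combination e3 - k * hsum), rfl,
      key (by linear_combination e5 - k * hsum), key (by linear_combination e6 - k * hsum)⟩
  · simp only [eval_mul, eval_pow, eval_sub, eval_X, eval_C]
    ring

/-- With `l` at every leaf and equal edge weights `k`, vectors supported on the leaves with sum zero
form the `l`-eigenspace. The remaining quadratic factor has roots `m` and `n` when `3 k ^ 2 = (l -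
m) (n - l)`, which is positive since `l` lies between them. -/
theorem exists_claw (l m n : ℝ) (hml : m < l) (hln : l < n) :
    ∃ A ∈ describedBy (graph4 true true true false false false), HasSSP A ∧
      A.charpoly = (X - C l) ^ 2 * (X - C m) * (X - C n) := by
  have hpos : 0 < (l - m) * (n - l) / 3 :=
    div_pos (mul_pos (sub_pos.2 hml) (sub_pos.2 hln)) (by norm_num)
  obtain ⟨k, hk⟩ : ∃ k, k = √((l - m) * (n - l) / 3) := ⟨_, rfl⟩
  have hk2 : k ^ 2 = (l - m) * (n - l) / 3 := by rw [hk]; exact Real.sq_sqrt hpos.le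
  have h0 : k ≠ 0 := by rintro rfl; simp at hk2; grind
  refine ⟨sym4 (m + n - l) l l l k k k 0 0 0,
    sym4_mem_describedBy (by simp [h0]) (by simp [h0]) (by simp [h0]) (by simp)
      (by simp) (by simp), sym4_hasSSP ?_, sym4_charpoly fun t => ?_⟩
  · intro p q r s t u h1 h2 h3 _ _ _ e1 e2 e3 _ _ _
    have hp := (mul_eq_zero.1 h1).resolve_left h0
    have hq := (mul_eq_zero.1 h2).resolve_left h0
    have hr := (mul_eq_zero.1 h3).resolve_left h0
    subst hp hq hr
    have key {v : ℝ} (h : k * v = 0) : v = 0 := (mul_eq_zero.1 h).resolve_left h0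
    exact ⟨rfl, rfl, rfl, key (by linear_combination (e1 + e2 - e3) / 2),
      key (by linear_combination (e1 + e3 - e2) / 2), key (by linear_combination (e2 + e3 - e1) / 2)⟩
  · simp only [eval_mul, eval_pow, eval_sub, eval_X, eval_C]
    linear_combination (3 * (t - l) ^ 2) * hk2

/-- The matrix is invariant under the reflection exchanging `0, 1` and `2, 3`. After subtracting
`l`, its even and odd blocks have diagonals `e₁, e₂` and `o₁, o₂` and common off-diagonal entry `s`;
each block is singular, with traces `x` and `y`. The values `m` and `n` may coincide. -/
theorem exists_cycle (l m n : ℝ) (hm : l ≠ m) (hn : l ≠ n) :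
    ∃ A ∈ describedBy (graph4 true false true true false true), HasSSP A ∧
      A.charpoly = (X - C l) ^ 2 * (X - C m) * (X - C n) := by
  obtain ⟨x, rfl⟩ : ∃ x, m = l + x := ⟨m - l, by ring⟩
  obtain ⟨y, rfl⟩ : ∃ y, n = l + y := ⟨n - l, by ring⟩
  have hx : x ≠ 0 := by rintro rfl; simp at hm
  have hy : y ≠ 0 := by rintro rfl; simp at hn
  have hx2 : 0 < x ^ 2 := by positivity
  have hy2 : 0 < y ^ 2 := by positivity
  -- This rational solution of `e₁ + e₂ = x`, `o₁ + o₂ = y`, `e₁ e₂ = o₁ o₂ = s ^ 2` keeps all four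
  -- edge weights nonzero for every nonzero `x` and `y`, whatever their signs.
  obtain ⟨D, hD⟩ : ∃ D, D = x ^ 4 + x ^ 2 * y ^ 2 + y ^ 4 := ⟨_, rfl⟩
  have hD0 : D ≠ 0 := by rw [hD]; positivity
  obtain ⟨e₁, he₁⟩ : ∃ v, v = x * y ^ 4 / D := ⟨_, rfl⟩
  obtain ⟨e₂, he₂⟩ : ∃ v, v = x ^ 3 * (x ^ 2 + y ^ 2) / D := ⟨_, rfl⟩
  obtain ⟨o₁, ho₁⟩ : ∃ v, v = y ^ 3 * (x ^ 2 + y ^ 2) / D := ⟨_, rfl⟩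
  obtain ⟨o₂, ho₂⟩ : ∃ v, v = x ^ 4 * y / D := ⟨_, rfl⟩
  obtain ⟨s, hs⟩ : ∃ v, v = x ^ 2 * y ^ 2 * √(x ^ 2 + y ^ 2) / D := ⟨_, rfl⟩
  have hs0 : s ≠ 0 := by rw [hs]; positivity
  have hsq : s ^ 2 = x ^ 4 * y ^ 4 * (x ^ 2 + y ^ 2) / D ^ 2 := by
    rw [hs, div_pow, mul_pow, Real.sq_sqrt (by positivity)]; ring
  have he : e₁ + e₂ = x := by rw [he₁, he₂]; field_simp; rw [hD]; ring
  have ho : o₁ + o₂ = y := by rw [ho₁, ho₂]; field_simp; rw [hD]; ring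
  have hes : e₁ * e₂ = s ^ 2 := by rw [he₁, he₂, hsq]; field_simp
  have hos : o₁ * o₂ = s ^ 2 := by rw [ho₁, ho₂, hsq]; field_simp
  have hw : 0 < x ^ 2 + y ^ 2 - x * y := by nlinarith [sq_nonneg (x - y)]
  have ha : (e₁ - o₁) / 2 = - (y ^ 3 * (x ^ 2 + y ^ 2 - x * y)) / (2 * D) := by
    rw [he₁, ho₁]; field_simp; ring
  have hc : (e₂ - o₂) / 2 = x ^ 3 * (x ^ 2 + y ^ 2 - x * y) / (2 * D) := by
    rw [he₂, ho₂]; field_simp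
  have ha0 : (e₁ - o₁) / 2 ≠ 0 := by
    rw [ha]
    exact div_ne_zero (neg_ne_zero.2 (mul_ne_zero (pow_ne_zero _ hy) hw.ne')) (by positivity)
  have hc0 : (e₂ - o₂) / 2 ≠ 0 := by
    rw [hc]
    exact div_ne_zero (mul_ne_zero (pow_ne_zero _ hx) hw.ne') (by positivity)
  have hw' : 0 < x ^ 2 + y ^ 2 + x * y := by nlinarith [sq_nonneg (x + y)]
  refine ⟨sym4 (l + (e₁ + o₁) / 2) (l + (e₁ + o₁) / 2) (l + (e₂ + o₂) / 2) (l + (e₂ + o₂) / 2)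
    ((e₁ - o₁) / 2) 0 s s 0 ((e₂ - o₂) / 2),
    sym4_mem_describedBy (by simpa using ha0) (by simp) (by simpa using hs0) (by simpa using hs0)
      (by simp) (by simpa using hc0), sym4_hasSSP ?_, sym4_charpoly fun t => ?_⟩
  · intro p q r v t u h1 _ h3 h4 _ h6 e1 e2 e3 e4 e5 e6
    have hp := (mul_eq_zero.1 h1).resolve_left ha0
    have hr := (mul_eq_zero.1 h3).resolve_left hs0
    have hv := (mul_eq_zero.1 h4).resolve_left hs0
    have hu := (mul_eq_zero.1 h6).resolve_left hc0
    subst hp hr hv hu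
    have hqt : t = q := mul_left_cancel₀ hs0 (by linear_combination e1)
    subst hqt
    -- The two coefficients of `t` are nonzero multiples of `y ^ 3 - x ^ 3` and `y ^ 3 + x ^ 3`,
    -- which cannot both vanish.
    have q1 : ((e₁ + o₁) / 2 - (e₂ + o₂) / 2) * t = 0 := by linear_combination e2
    have q2 : ((e₁ - o₁) / 2 - (e₂ - o₂) / 2) * t = 0 := by linear_combination e3
    have r1 : (y ^ 3 - x ^ 3) * t = 0 := by
      have hk : (e₁ + o₁) / 2 - (e₂ + o₂) / 2
          = (y ^ 3 - x ^ 3) * ((x ^ 2 + y ^ 2 + x * y) / (2 * D)) := by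
        rw [he₁, ho₁, he₂, ho₂]; field_simp; ring
      rw [hk, mul_right_comm] at q1
      exact (mul_eq_zero.1 q1).resolve_right (by positivity)
    have r2 : (y ^ 3 + x ^ 3) * t = 0 := by
      have hk : (e₁ - o₁) / 2 - (e₂ - o₂) / 2
          = (y ^ 3 + x ^ 3) * (-((x ^ 2 + y ^ 2 - x * y) / (2 * D))) := by
        rw [ha, hc]; field_simp; ring
      rw [hk, mul_right_comm] at q2
      exact (mul_eq_zero.1 q2).resolve_right (neg_ne_zero.2 (by positivity))
    have ht : t = 0 := by
      have : x ^ 3 * t = 0 := by linear_combination (r2 - r1) / 2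
      exact (mul_eq_zero.1 this).resolve_left (pow_ne_zero _ hx)
    simp [ht]
  · have key : ∀ t : ℝ, (t - e₁) * (t - e₂) - s ^ 2 = t * (t - x) := fun t => by
      linear_combination hes - t * he
    have key' : ∀ t : ℝ, (t - o₁) * (t - o₂) - s ^ 2 = t * (t - y) := fun t => by
      linear_combination hos - t * ho
    simp only [eval_mul, eval_pow, eval_sub, eval_X, eval_C]
    have h1 := key (t - l)
    have h2 := key' (t - l)
    calc _ = ((t - l) * (t - l - x)) * ((t - l) * (t - l - y)) := by ring
      _ = _ := by rw [← h1, ← h2]; ring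

end FinFour
-- Combinatorial obstructions to eigenvalue multiplicities
section Obstructions

set_option linter.unusedSectionVars false

variable {V : Type*} [Fintype V] [DecidableEq V] {G : SimpleGraph V} {A : Matrix V V ℝ}

theorem apply_eq_zero_of_not_adj (hA : A ∈ describedBy G) {i j : V} (hij : i ≠ j)
    (h : ¬ G.Adj i j) : A i j = 0 := by
  by_contra h'
  exact h ((hA.2 i j hij).1 h')

/-- Otherwise some eigenvector is supported on `j` alone, and row `i` of the eigenvalue equation
contradicts `A i j ≠ 0`. -/
theorem mult_lt_card_of_adj (hA : A ∈ describedBy G) {i j : V} (h : G.Adj i j) (μ : ℝ) :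
    mult A μ < Fintype.card V := by
  by_contra! hc
  obtain ⟨v, hv0, hv, hvs⟩ := exists_eigenvector_vanishing hA.1 (μ := μ) (Finset.univ.erase j) (by
    rw [Finset.card_erase_of_mem (Finset.mem_univ j), Finset.card_univ]
    have := Fintype.card_pos_iff.2 ⟨j⟩
    omega)
  have hz (k) (hk : k ≠ j) : v k = 0 := hvs k (by simp [hk])
  have hrow := congrFun hv i
  rw [Matrix.mulVec, dotProduct, Finset.sum_eq_single j (fun k _ hk => by rw [hz k hk, mul_zero])
    (by simp), Pi.smul_apply, hz i h.ne, smul_zero] at hrow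
  refine hv0 (funext fun k => ?_)
  by_cases hk : k = j
  · rw [hk]; exact (mul_eq_zero.1 hrow).resolve_left ((hA.2 i j h.ne).2 h)
  · exact hz k hk

/-- Otherwise some eigenvector is supported on `{j, k}`. Row `i` sees only `j` and forces `v j = 0`;
row `j` then forces `v k = 0`. -/
theorem mult_lt_of_induced_path (hA : A ∈ describedBy G) {i j k : V} (hij : G.Adj i j)
    (hjk : G.Adj j k) (hne : i ≠ k) (hik : ¬ G.Adj i k) (μ : ℝ) :
    mult A μ + 1 < Fintype.card V := by
  by_contra! hc
  obtain ⟨v, hv0, hv, hvs⟩ := exists_eigenvector_vanishing hA.1 (μ := μ)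
    ((Finset.univ.erase j).erase k) (by
    rw [Finset.card_erase_of_mem (by simp [hjk.ne']), Finset.card_erase_of_mem (Finset.mem_univ j),
      Finset.card_univ]
    have h2 : 1 < Fintype.card V := Fintype.one_lt_card_iff.2 ⟨i, k, hne⟩
    omega)
  have hz (l) (h1 : l ≠ j) (h2 : l ≠ k) : v l = 0 := hvs l (by simp [h1, h2])
  have hi := congrFun hv i
  rw [Matrix.mulVec, dotProduct, Finset.sum_eq_single j (fun l _ hl => by
      by_cases hlk : l = k
      · rw [hlk, apply_eq_zero_of_not_adj hA hne hik, zero_mul]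
      · rw [hz l hl hlk, mul_zero]) (by simp), Pi.smul_apply, hz i hij.ne hne, smul_zero] at hi
  have hvj : v j = 0 := (mul_eq_zero.1 hi).resolve_left ((hA.2 i j hij.ne).2 hij)
  have hz' (l) (h2 : l ≠ k) : v l = 0 := by
    by_cases h1 : l = j
    · rw [h1, hvj]
    · exact hz l h1 h2
  have hj := congrFun hv j
  rw [Matrix.mulVec, dotProduct, Finset.sum_eq_single k (fun l _ hl => by rw [hz' l hl, mul_zero])
    (by simp), Pi.smul_apply, hvj, smul_zero] at hj
  refine hv0 (funext fun l => ?_)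
  by_cases hk : l = k
  · rw [hk]; exact (mul_eq_zero.1 hj).resolve_left ((hA.2 j k hjk.ne).2 hjk)
  · exact hz' l hk

/-- If two nonadjacent vertices have exactly one common neighbour, then every matrix described by
the graph has at least three eigenvalues. -/
theorem exists_third_eigenvalue (hA : A ∈ describedBy G) {i j k : V} (hij : G.Adj i j)
    (hjk : G.Adj j k) (hne : i ≠ k) (hik : ¬ G.Adj i k)
    (huniq : ∀ l, G.Adj i l → G.Adj l k → l = j) (a b : ℝ) :
    ∃ μ ∈ eigenvalueSet A, μ ≠ a ∧ μ ≠ b := by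
  by_contra! hc
  have h0 := congrFun (congrFun (sub_mul_sub_eq_zero hA.1 (a := a) (b := b)
    fun μ hμ => or_iff_not_imp_left.2 (hc μ hμ)) i) k
  have hA0 := apply_eq_zero_of_not_adj hA hne hik
  -- Only the common neighbour `j` contributes to the `(i, k)` entry of `(A - a)(A - b)`, which is
  -- therefore `A i j * A j k ≠ 0`.
  rw [Matrix.mul_apply, Finset.sum_eq_single j (fun l _ hl => ?_) (by simp)] at h0
  · simp only [Matrix.sub_apply, Matrix.smul_apply, Matrix.one_apply_ne hij.ne,
      Matrix.one_apply_ne hjk.ne, smul_zero, sub_zero, Matrix.zero_apply] at h0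
    exact mul_ne_zero ((hA.2 i j hij.ne).2 hij) ((hA.2 j k hjk.ne).2 hjk) h0
  · by_cases hli : l = i
    · subst hli; simp [hA0, hne]
    by_cases hlk : l = k
    · subst hlk; simp [hA0, hne]
    rw [Matrix.sub_apply, Matrix.sub_apply, Matrix.smul_apply, Matrix.smul_apply,
      Matrix.one_apply_ne (Ne.symm hli), Matrix.one_apply_ne hlk, smul_zero, smul_zero, sub_zero,
      sub_zero]
    by_cases h1 : G.Adj i l
    · rw [apply_eq_zero_of_not_adj hA hlk fun h2 => hl (huniq l h1 h2), mul_zero]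
    · rw [apply_eq_zero_of_not_adj hA (Ne.symm hli) h1, zero_mul]

end Obstructions

/-! ### Reading eigenvalues off an ordered multiplicity list -/

section Lists

variable {V : Type*} [Fintype V] [DecidableEq V] {A : Matrix V V ℝ}

theorem exists_mult_eq_forall_le {k : ℕ} {t : List ℕ} (h : oml A = k :: t) :
    ∃ μ, mult A μ = k ∧ ∀ ν ∈ eigenvalueSet A, μ ≤ ν := by
  obtain ⟨μ, l, hl, hμ, -⟩ := List.map_eq_cons_iff.1 h
  have hs := Finset.pairwise_sort (eigenvalueSet A) (· ≤ ·)
  rw [hl, List.pairwise_cons] at hs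
  refine ⟨μ, hμ, fun ν hν => ?_⟩
  rw [← Finset.mem_sort (· ≤ ·), hl, List.mem_cons] at hν
  rcases hν with rfl | hν
  · exact le_rfl
  · exact hs.1 ν hν

theorem exists_mult_eq_forall_ge {k : ℕ} {t : List ℕ} (h : oml A = t ++ [k]) :
    ∃ μ, mult A μ = k ∧ ∀ ν ∈ eigenvalueSet A, ν ≤ μ := by
  obtain ⟨l, l', hl, -, hl'⟩ := List.map_eq_append_iff.1 h
  obtain ⟨μ, rfl, hμ⟩ := List.map_eq_singleton_iff.1 hl'
  have hs := Finset.pairwise_sort (eigenvalueSet A) (· ≤ ·)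
  rw [hl, List.pairwise_append] at hs
  refine ⟨μ, hμ, fun ν hν => ?_⟩
  rw [← Finset.mem_sort (· ≤ ·), hl, List.mem_append, List.mem_singleton] at hν
  rcases hν with hν | rfl
  · exact hs.2.2 ν hν μ (by simp)
  · exact le_rfl

theorem exists_forall_eq_or_eq {k l : ℕ} (h : oml A = [k, l]) :
    ∃ a b, ∀ ν ∈ eigenvalueSet A, ν = a ∨ ν = b := by
  obtain ⟨a, t, ht, -, ht'⟩ := List.map_eq_cons_iff.1 h
  obtain ⟨b, rfl, -⟩ := List.map_eq_singleton_iff.1 ht'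
  refine ⟨a, b, fun ν hν => ?_⟩
  rw [← Finset.mem_sort (· ≤ ·), ht] at hν
  simpa using hν

theorem eq_of_sum_eq_four {l : List ℕ} (hpos : ∀ k ∈ l, 0 < k) (hsum : l.sum = 4) :
    l = [1, 1, 1, 1] ∨ l = [1, 2, 1] ∨ l = [2, 1, 1] ∨ l = [1, 1, 2] ∨ l = [2, 2] ∨ l = [3, 1] ∨
      l = [1, 3] ∨ l = [4] := by
  rcases l with _ | ⟨a, _ | ⟨b, _ | ⟨c, _ | ⟨d, _ | ⟨e, t⟩⟩⟩⟩⟩ <;>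
    simp at hpos hsum ⊢ <;> omega

theorem mem_of_mem_attainedLists {G : SimpleGraph (Fin 4)} {m : List ℕ}
    (h : m ∈ attainedLists G) :
    m = [1, 1, 1, 1] ∨ m = [1, 2, 1] ∨ m = [2, 1, 1] ∨ m = [1, 1, 2] ∨ m = [2, 2] ∨ m = [3, 1] ∨
      m = [1, 3] ∨ m = [4] := by
  obtain ⟨A, hA, rfl⟩ := h
  exact eq_of_sum_eq_four (fun k hk => pos_of_mem_oml hk) (sum_oml hA.1)

end Lists

/-! ### Lists excluded for particular graphs of order 4 -/

section Graphs

/-- The path with edges `01`, `12`, `23`. -/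
abbrev path' : SimpleGraph (Fin 4) := graph4 true false false true false true
/-- The claw with centre `0`. -/
abbrev claw' : SimpleGraph (Fin 4) := graph4 true true true false false false
/-- The triangle `012` with the pendant edge `23`. -/
abbrev paw' : SimpleGraph (Fin 4) := graph4 true true false true false true
/-- The cycle `0123`. -/
abbrev cycle' : SimpleGraph (Fin 4) := graph4 true false true true false true
/-- The complete graph without the edge `01`. -/
abbrev diamond' : SimpleGraph (Fin 4) := graph4 false true true true true true
/-- The complete graph. -/
abbrev complete' : SimpleGraph (Fin 4) := graph4 true true true true true true
/-- The triangle `012` with an isolated vertex. -/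
abbrev triangle' : SimpleGraph (Fin 4) := graph4 true true false true false false
/-- The graph without edges. -/
abbrev empty' : SimpleGraph (Fin 4) := graph4 false false false false false false

variable {A : Matrix (Fin 4) (Fin 4) ℝ} {G : SimpleGraph (Fin 4)}

theorem four_notMem_attainedLists {i j : Fin 4} (h : G.Adj i j) : [4] ∉ attainedLists G := by
  rintro ⟨A, hA, hm⟩
  obtain ⟨μ, -, hμ⟩ := mem_oml.1 (show 4 ∈ oml A by simp [hm])
  have := mult_lt_card_of_adj hA h μ
  simp [hμ] at this

theorem three_notMem_of_mem_attainedLists {i j k : Fin 4} (hij : G.Adj i j) (hjk : G.Adj j k)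
    (hne : i ≠ k) (hik : ¬ G.Adj i k) {m : List ℕ} (hm : m ∈ attainedLists G) : 3 ∉ m := by
  obtain ⟨A, hA, rfl⟩ := hm
  intro h
  obtain ⟨μ, -, hμ⟩ := mem_oml.1 h
  have := mult_lt_of_induced_path hA hij hjk hne hik μ
  simp [hμ] at this

theorem two_two_notMem_attainedLists {i j k : Fin 4} (hij : G.Adj i j) (hjk : G.Adj j k)
    (hne : i ≠ k) (hik : ¬ G.Adj i k) (huniq : ∀ l, G.Adj i l → G.Adj l k → l = j) :
    [2, 2] ∉ attainedLists G := by
  rintro ⟨A, hA, hm⟩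
  obtain ⟨a, b, hab⟩ := exists_forall_eq_or_eq hm
  obtain ⟨μ, hμ, h1, h2⟩ := exists_third_eigenvalue hA hij hjk hne hik huniq a b
  exact (hab μ hμ).elim h1 h2

/-- A double eigenvalue would have a nonzero eigenvector vanishing at an end of the path, and the
rows `0, 1, 2` propagate the zero along it. -/
theorem two_notMem_of_mem_attainedLists_path {m : List ℕ} (hm : m ∈ attainedLists path') :
    2 ∉ m := by
  obtain ⟨A, hA, rfl⟩ := hm
  intro h
  obtain ⟨μ, -, hμ⟩ := mem_oml.1 h
  obtain ⟨v, hv0, hv, hvs⟩ := exists_eigenvector_vanishing hA.1 (μ := μ) {0} (by simp [hμ])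
  have h0 : v 0 = 0 := hvs 0 (by simp)
  have hz {i j} (hij : i ≠ j) (h : ¬ path'.Adj i j) := apply_eq_zero_of_not_adj hA hij h
  have hn {i j} (hij : i ≠ j) (h : path'.Adj i j) := (hA.2 i j hij).2 h
  have hr (i) : A i 0 * v 0 + A i 1 * v 1 + A i 2 * v 2 + A i 3 * v 3 = μ * v i := by
    have := congrFun hv i
    rwa [Matrix.mulVec, dotProduct, Fin.sum_univ_four] at this
  have h1 : v 1 = 0 := by
    have := hr 0
    rw [h0, hz (i := 0) (j := 2) (by decide) (by decide),
      hz (i := 0) (j := 3) (by decide) (by decide)] at this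
    simpa [hn (i := 0) (j := 1) (by decide) (by decide)] using this
  have h2 : v 2 = 0 := by
    have := hr 1
    rw [h0, h1, hz (i := 1) (j := 3) (by decide) (by decide)] at this
    simpa [hn (i := 1) (j := 2) (by decide) (by decide)] using this
  have h3 : v 3 = 0 := by
    have := hr 2
    rw [h0, h1, h2] at this
    simpa [hn (i := 2) (j := 3) (by decide) (by decide)] using this
  exact hv0 (by ext i; fin_cases i <;> assumption)

/-- In the claw, the diagonal entry at some leaf equals any given double eigenvalue. -/
theorem exists_leaf_apply_eq (hA : A ∈ describedBy claw') {μ : ℝ} (hμ : mult A μ = 2) :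
    ∃ i, i ≠ 0 ∧ A i i = μ := by
  -- For an eigenvector vanishing at the centre, the row of a leaf `i` in its support reads `A i i *
  -- v i = μ * v i`.
  obtain ⟨v, hv0, hv, hvs⟩ := exists_eigenvector_vanishing hA.1 (μ := μ) {0} (by simp [hμ])
  have h0 : v 0 = 0 := hvs 0 (by simp)
  obtain ⟨i, hi⟩ := Function.ne_iff.1 hv0
  have hi0 : i ≠ 0 := by rintro rfl; exact hi h0
  refine ⟨i, hi0, ?_⟩
  have hadj : ∀ i j : Fin 4, i ≠ 0 → j ≠ 0 → ¬ claw'.Adj i j := by decide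
  have hrow := congrFun hv i
  rw [Matrix.mulVec, dotProduct, Finset.sum_eq_single i (fun j _ hj => ?_) (by simp),
    Pi.smul_apply, smul_eq_mul] at hrow
  · exact mul_right_cancel₀ hi hrow
  · by_cases hj0 : j = 0
    · rw [hj0, h0, mul_zero]
    · rw [apply_eq_zero_of_not_adj hA hj.symm (hadj i j hi0 hj0), zero_mul]

theorem not_extremal_of_mem_describedBy_claw (hA : A ∈ describedBy claw') {s μ : ℝ}
    (hs : s * s = 1) (hμ : mult A μ = 2) : ¬ ∀ ν ∈ eigenvalueSet A, 0 ≤ s * (ν - μ) := by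
  intro h
  obtain ⟨i, hi0, hi⟩ := exists_leaf_apply_eq hA hμ
  have hadj : ∀ i : Fin 4, i ≠ 0 → claw'.Adj i 0 := by decide
  exact (hA.2 i 0 hi0).2 (hadj i hi0) (apply_eq_zero_of_extremal hA.1 hs h hi0 hi)

theorem two_one_one_notMem_attainedLists_claw : [2, 1, 1] ∉ attainedLists claw' := by
  rintro ⟨A, hA, hm⟩
  obtain ⟨μ, hμ, h⟩ := exists_mult_eq_forall_le hm
  exact not_extremal_of_mem_describedBy_claw hA (s := 1) (by norm_num) hμ
    fun ν hν => by linarith [h ν hν]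

theorem one_one_two_notMem_attainedLists_claw : [1, 1, 2] ∉ attainedLists claw' := by
  rintro ⟨A, hA, hm⟩
  obtain ⟨μ, hμ, h⟩ := exists_mult_eq_forall_ge (t := [1, 1]) hm
  exact not_extremal_of_mem_describedBy_claw hA (s := -1) (by norm_num) hμ
    fun ν hν => by linarith [h ν hν]

end Graphs

/-! ### Spectral arbitrariness of the basic lists -/

section Arbitrary

open Polynomial

variable {V : Type*} [Fintype V] [DecidableEq V] {G : SimpleGraph V}

theorem spectrallyArbitraryWithSSP_pair {a b : ℕ} (ha : 0 < a) (hb : 0 < b)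
    (h : ∀ x y : ℝ, x < y → ∃ A ∈ describedBy G, HasSSP A ∧
      A.charpoly = (X - C x) ^ a * (X - C y) ^ b) : SpectrallyArbitraryWithSSP [a, b] G := by
  refine spectrallyArbitraryWithSSP_of_charpoly (fun i => ?_) fun lam hlam => ?_
  · fin_cases i <;> assumption
  · obtain ⟨A, hA, hS, hc⟩ := h (lam 0) (lam 1)
      (hlam (show (0 : Fin 2) < 1 by decide))
    exact ⟨A, hA, hS, hc.trans (Fin.prod_univ_two fun i => (X - C (lam i)) ^ [a, b].get i).symm⟩

theorem spectrallyArbitraryWithSSP_triple {a b c : ℕ} (ha : 0 < a) (hb : 0 < b) (hc : 0 < c)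
    (h : ∀ x y z : ℝ, x < y → y < z → ∃ A ∈ describedBy G, HasSSP A ∧
      A.charpoly = (X - C x) ^ a * (X - C y) ^ b * (X - C z) ^ c) :
    SpectrallyArbitraryWithSSP [a, b, c] G := by
  refine spectrallyArbitraryWithSSP_of_charpoly (fun i => ?_) fun lam hlam => ?_
  · fin_cases i <;> assumption
  · obtain ⟨A, hA, hS, hc⟩ := h (lam 0) (lam 1) (lam 2)
      (hlam (show (0 : Fin 3) < 1 by decide)) (hlam (show (1 : Fin 3) < 2 by decide))
    exact ⟨A, hA, hS,
      hc.trans (Fin.prod_univ_three fun i => (X - C (lam i)) ^ [a, b, c].get i).symm⟩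

theorem one_one_one_one_arbitrary_empty : SpectrallyArbitraryWithSSP [1, 1, 1, 1] empty' := by
  refine spectrallyArbitraryWithSSP_of_charpoly (by decide) fun lam hlam => ?_
  have hne {i j : Fin 4} (hij : i ≠ j) : lam i ≠ lam j := hlam.injective.ne hij
  obtain ⟨A, hA, hS, hc⟩ := exists_empty (lam 0) (lam 1) (lam 2) (lam 3) (hne (by decide))
    (hne (by decide)) (hne (by decide)) (hne (by decide)) (hne (by decide)) (hne (by decide))
  refine ⟨A, hA, hS, ?_⟩
  refine Eq.trans ?_ (Fin.prod_univ_four fun i => (X - C (lam i)) ^ [1, 1, 1, 1].get i).symm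
  rw [hc]
  exact congrArg₂ _ (congrArg₂ _ (congrArg₂ _ (pow_one _).symm (pow_one _).symm) (pow_one _).symm)
    (pow_one _).symm

theorem three_one_arbitrary_complete : SpectrallyArbitraryWithSSP [3, 1] complete' :=
  spectrallyArbitraryWithSSP_pair (by decide) (by decide) fun x y hxy => by
    simpa using exists_complete x y hxy.ne

theorem one_three_arbitrary_complete : SpectrallyArbitraryWithSSP [1, 3] complete' :=
  spectrallyArbitraryWithSSP_pair (by decide) (by decide) fun x y hxy => by
    simpa [mul_comm] using exists_complete y x hxy.ne'

theorem two_two_arbitrary_cycle : SpectrallyArbitraryWithSSP [2, 2] cycle' :=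
  spectrallyArbitraryWithSSP_pair (by decide) (by decide) fun x y hxy => by
    -- The two remaining eigenvalues of the cycle matrix are taken equal.
    simpa [mul_assoc, ← sq] using exists_cycle x y y hxy.ne hxy.ne

/-- A graph for which a double eigenvalue and any two other distinct eigenvalues can be prescribed
attains the lists `(1, 2, 1)`, `(2, 1, 1)` and `(1, 1, 2)` spectrally arbitrarily. -/
theorem arbitrary_of_double (h : ∀ l m n : ℝ, l ≠ m → l ≠ n → m ≠ n →
      ∃ A ∈ describedBy G, HasSSP A ∧ A.charpoly = (X - C l) ^ 2 * (X - C m) * (X - C n)) :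
    SpectrallyArbitraryWithSSP [1, 2, 1] G ∧ SpectrallyArbitraryWithSSP [2, 1, 1] G ∧
      SpectrallyArbitraryWithSSP [1, 1, 2] G := by
  refine ⟨spectrallyArbitraryWithSSP_triple (by decide) (by decide) (by decide) fun x y z h1 h2 => ?_,
    spectrallyArbitraryWithSSP_triple (by decide) (by decide) (by decide) fun x y z h1 h2 => ?_,
    spectrallyArbitraryWithSSP_triple (by decide) (by decide) (by decide) fun x y z h1 h2 => ?_⟩
  · obtain ⟨A, hA, hS, hc⟩ := h y x z h1.ne' h2.ne (h1.trans h2).ne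
    exact ⟨A, hA, hS, hc.trans (by ring)⟩
  · obtain ⟨A, hA, hS, hc⟩ := h x y z h1.ne (h1.trans h2).ne h2.ne
    exact ⟨A, hA, hS, hc.trans (by ring)⟩
  · obtain ⟨A, hA, hS, hc⟩ := h z x y (h1.trans h2).ne' h2.ne' h1.ne
    exact ⟨A, hA, hS, hc.trans (by ring)⟩

theorem arbitrary_cycle : SpectrallyArbitraryWithSSP [1, 2, 1] cycle' ∧
    SpectrallyArbitraryWithSSP [2, 1, 1] cycle' ∧ SpectrallyArbitraryWithSSP [1, 1, 2] cycle' :=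
  arbitrary_of_double fun l m n h1 h2 _ => exists_cycle l m n h1 h2

theorem arbitrary_triangle : SpectrallyArbitraryWithSSP [1, 2, 1] triangle' ∧
    SpectrallyArbitraryWithSSP [2, 1, 1] triangle' ∧
    SpectrallyArbitraryWithSSP [1, 1, 2] triangle' :=
  arbitrary_of_double exists_triangle

theorem one_two_one_arbitrary_claw : SpectrallyArbitraryWithSSP [1, 2, 1] claw' :=
  spectrallyArbitraryWithSSP_triple (by decide) (by decide) (by decide) fun x y z h1 h2 => by
    obtain ⟨A, hA, hS, hc⟩ := exists_claw y x z h1 h2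
    exact ⟨A, hA, hS, hc.trans (by ring)⟩

end Arbitrary

/-! ### Spanning copies and minimal graphs -/

section Copies

variable {V : Type*}

/-- `G` contains a copy of `H` as a spanning subgraph. -/
def HasCopy (H G : SimpleGraph V) : Prop :=
  ∃ σ : Equiv.Perm V, ∀ i j, H.Adj (σ i) (σ j) → G.Adj i j

theorem HasCopy.exists_comap_le {H G : SimpleGraph V} (h : HasCopy H G) :
    ∃ σ : Equiv.Perm V, H.comap σ ≤ G := by
  obtain ⟨σ, hσ⟩ := h
  exact ⟨σ, fun i j hij => hσ i j hij⟩

variable [Fintype V] [DecidableEq V]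

theorem AttainsWithSSP.of_hasCopy {m : List ℕ} {H G : SimpleGraph V} (h : AttainsWithSSP m H)
    (hc : HasCopy H G) : AttainsWithSSP m G := by
  obtain ⟨σ, hσ⟩ := hc.exists_comap_le
  exact (h.of_iso (SimpleGraph.Iso.comap σ H).symm).mono hσ

theorem SpectrallyArbitraryWithSSP.of_hasCopy {m : List ℕ} {H G : SimpleGraph V}
    (h : SpectrallyArbitraryWithSSP m H) (hc : HasCopy H G) : SpectrallyArbitraryWithSSP m G := by
  obtain ⟨σ, hσ⟩ := hc.exists_comap_le
  exact (h.of_iso (SimpleGraph.Iso.comap σ H).symm).mono hσ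

/-- If the graphs attaining `m` with the SSP are those containing a copy of a graph in `L`, and
copies of graphs in `L` are not properly contained in graphs in `L`, then the minimal graphs for
`m` are those in `L`, up to isomorphism. -/
theorem isMinimalForSSP_iff {m : List ℕ} {L : Set (SimpleGraph V)}
    (hL : ∀ H ∈ L, AttainsWithSSP m H)
    (hcopy : ∀ G, AttainsWithSSP m G → ∃ H ∈ L, HasCopy H G)
    (hanti : ∀ H ∈ L, ∀ H' ∈ L, ∀ σ : Equiv.Perm V, (∀ i j, H.Adj (σ i) (σ j) → H'.Adj i j) →
      ∀ i j, H'.Adj i j → H.Adj (σ i) (σ j)) (G : SimpleGraph V) :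
    IsMinimalForSSP m G ↔ ∃ H ∈ L, Iso G H := by
  constructor
  · rintro ⟨hG, hmin⟩
    obtain ⟨H, hH, hc⟩ := hcopy G hG
    obtain ⟨σ, hσ⟩ := hc.exists_comap_le
    have hle := hmin ((hL H hH).of_iso (SimpleGraph.Iso.comap σ H).symm) hσ
    refine ⟨H, hH, ⟨?_⟩⟩
    rw [hle.antisymm hσ]
    exact SimpleGraph.Iso.comap σ H
  · rintro ⟨H, hH, ⟨e⟩⟩
    refine ⟨(hL H hH).of_iso e.symm, fun G' hG' hle => ?_⟩
    obtain ⟨H', hH', σ, hσ⟩ := hcopy G' hG'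
    intro i j hij
    have hτ (x) : (e.toEquiv.symm.trans σ) (e x) = σ x :=
      congrArg σ (e.toEquiv.symm_apply_apply x)
    -- Relabelled by `e`, the copy of `H'` inside `G' ≤ G` is a copy inside `H`. By `hanti` it has
    -- all the edges of `H`, so `G'` has all those of `G`.
    have := hanti H' hH' H hH (e.toEquiv.symm.trans σ) (fun i j h => by
      obtain ⟨i, rfl⟩ := e.surjective i
      obtain ⟨j, rfl⟩ := e.surjective j
      rw [hτ, hτ] at h
      exact e.map_adj_iff.2 (hle (hσ _ _ h))) (e i) (e j) (e.map_adj_iff.2 hij)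
    rw [hτ, hτ] at this
    exact hσ i j this

end Copies

/-! ### Finite checks over the graphs of order 4 -/

section Classification

theorem exists_perm_eq {p q r s : Fin 4} (hpq : p ≠ q) (hpr : p ≠ r) (hps : p ≠ s) (hqr : q ≠ r)
    (hqs : q ≠ s) (hrs : r ≠ s) :
    ∃ σ : Equiv.Perm (Fin 4), σ 0 = p ∧ σ 1 = q ∧ σ 2 = r ∧ σ 3 = s := by
  have hinj : Function.Injective ![p, q, r, s] := by
    intro i j hij
    fin_cases i <;> fin_cases j <;> simp_all
  exact ⟨Equiv.ofBijective _ (Finite.injective_iff_bijective.1 hinj), rfl, rfl, rfl, rfl⟩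

theorem forall_fin_four_of_symm {P : Fin 4 → Fin 4 → Prop} (hrefl : ∀ i, P i i)
    (hsymm : ∀ i j, P i j → P j i) (h01 : P 0 1) (h02 : P 0 2) (h03 : P 0 3) (h12 : P 1 2)
    (h13 : P 1 3) (h23 : P 2 3) (i j : Fin 4) : P i j := by
  fin_cases i <;> fin_cases j <;> first | exact hrefl _ | assumption | (apply hsymm; assumption)

/-- The permutations of `Fin 4`, given by their values. -/
def perms4 : List (Fin 4 × Fin 4 × Fin 4 × Fin 4) :=
  [(0, 1, 2, 3), (0, 1, 3, 2), (0, 2, 1, 3), (0, 2, 3, 1), (0, 3, 1, 2), (0, 3, 2, 1),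
    (1, 0, 2, 3), (1, 0, 3, 2), (1, 2, 0, 3), (1, 2, 3, 0), (1, 3, 0, 2), (1, 3, 2, 0),
    (2, 0, 1, 3), (2, 0, 3, 1), (2, 1, 0, 3), (2, 1, 3, 0), (2, 3, 0, 1), (2, 3, 1, 0),
    (3, 0, 1, 2), (3, 0, 2, 1), (3, 1, 0, 2), (3, 1, 2, 0), (3, 2, 0, 1), (3, 2, 1, 0)]

/-- Compare the upper triangle of `u`, with permuted rows and columns, with that of `v`. -/
def compare4 (R : Bool → Bool → Bool) (u v : Fin 4 → Fin 4 → Bool) :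
    Fin 4 × Fin 4 × Fin 4 × Fin 4 → Bool
  | (p, q, r, s) => R (u p q) (v 0 1) && R (u p r) (v 0 2) && R (u p s) (v 0 3) &&
      R (u q r) (v 1 2) && R (u q s) (v 1 3) && R (u r s) (v 2 3)

theorem exists_perm_of_mem_perms4 {p q r s : Fin 4} (h : (p, q, r, s) ∈ perms4) :
    ∃ σ : Equiv.Perm (Fin 4), σ 0 = p ∧ σ 1 = q ∧ σ 2 = r ∧ σ 3 = s := by
  have hne : ∀ x ∈ perms4, x.1 ≠ x.2.1 ∧ x.1 ≠ x.2.2.1 ∧ x.1 ≠ x.2.2.2 ∧ x.2.1 ≠ x.2.2.1 ∧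
      x.2.1 ≠ x.2.2.2 ∧ x.2.2.1 ≠ x.2.2.2 := by decide +kernel
  obtain ⟨h1, h2, h3, h4, h5, h6⟩ := hne _ h
  exact exists_perm_eq h1 h2 h3 h4 h5 h6

theorem mem_perms4 (σ : Equiv.Perm (Fin 4)) : (σ 0, σ 1, σ 2, σ 3) ∈ perms4 := by
  have hmem : ∀ p q : Fin 4, p ≠ q → ∀ r, p ≠ r → q ≠ r → ∀ s, p ≠ s → q ≠ s →
      r ≠ s → (p, q, r, s) ∈ perms4 := by decide +kernel
  have hne {i j : Fin 4} (h : i ≠ j) : σ i ≠ σ j := σ.injective.ne h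
  exact hmem _ _ (hne (by decide)) _ (hne (by decide)) (hne (by decide)) _ (hne (by decide))
    (hne (by decide)) (hne (by decide))

/-- Whether the graph with the table `v` contains a copy of the graph with the table `u`. -/
def copyTest (u v : Fin 4 → Fin 4 → Bool) : Bool :=
  perms4.any (compare4 (fun x y => !x || y) u v)

/-- Whether the graphs with the tables `u` and `v` are isomorphic. -/
def isoTest (u v : Fin 4 → Fin 4 → Bool) : Bool := perms4.any (compare4 (fun x y => x == y) u v)

/-- Whether all copies of the graph with the table `u` contained in the graph with the table `v`
are equal to it. -/
def antiTest (u v : Fin 4 → Fin 4 → Bool) : Bool :=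
  perms4.all fun x => !compare4 (fun x y => !x || y) u v x || compare4 (fun x y => !y || x) u v x

variable {a b c d e f a' b' c' d' e' f' : Bool}

theorem hasCopy_of_copyTest (h : copyTest (table4 a b c d e f) (table4 a' b' c' d' e' f') = true) :
    HasCopy (graph4 a b c d e f) (graph4 a' b' c' d' e' f') := by
  obtain ⟨⟨p, q, r, s⟩, hx, h⟩ := List.any_eq_true.1 h
  obtain ⟨σ, rfl, rfl, rfl, rfl⟩ := exists_perm_of_mem_perms4 hx
  simp only [compare4, Bool.and_eq_true, Bool.or_eq_true, Bool.not_eq_true', ← Bool.not_eq_true,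
    ← imp_iff_not_or] at h
  obtain ⟨⟨⟨⟨⟨h01, h02⟩, h03⟩, h12⟩, h13⟩, h23⟩ := h
  exact ⟨σ, forall_fin_four_of_symm (fun i h => absurd rfl h.ne)
    (fun i j h h' => (h h'.symm).symm) h01 h02 h03 h12 h13 h23⟩

theorem iso_of_isoTest (h : isoTest (table4 a b c d e f) (table4 a' b' c' d' e' f') = true) :
    Iso (graph4 a' b' c' d' e' f') (graph4 a b c d e f) := by
  obtain ⟨⟨p, q, r, s⟩, hx, h⟩ := List.any_eq_true.1 h
  obtain ⟨σ, rfl, rfl, rfl, rfl⟩ := exists_perm_of_mem_perms4 hx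
  simp only [compare4, Bool.and_eq_true, beq_iff_eq] at h
  obtain ⟨⟨⟨⟨⟨h01, h02⟩, h03⟩, h12⟩, h13⟩, h23⟩ := h
  have key := forall_fin_four_of_symm
    (P := fun i j => (graph4 a b c d e f).Adj (σ i) (σ j) ↔ (graph4 a' b' c' d' e' f').Adj i j)
    (fun i => iff_of_false (fun h => h.ne rfl) (fun h => h.ne rfl))
    (fun i j h => by rw [SimpleGraph.adj_comm, SimpleGraph.adj_comm _ j]; exact h)
    (Bool.eq_iff_iff.1 h01) (Bool.eq_iff_iff.1 h02) (Bool.eq_iff_iff.1 h03)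
    (Bool.eq_iff_iff.1 h12) (Bool.eq_iff_iff.1 h13) (Bool.eq_iff_iff.1 h23)
  exact ⟨⟨σ, fun {i j} => key i j⟩⟩

theorem adj_of_antiTest (h : antiTest (table4 a b c d e f) (table4 a' b' c' d' e' f') = true)
    (σ : Equiv.Perm (Fin 4))
    (hσ : ∀ i j, (graph4 a b c d e f).Adj (σ i) (σ j) → (graph4 a' b' c' d' e' f').Adj i j) :
    ∀ i j, (graph4 a' b' c' d' e' f').Adj i j → (graph4 a b c d e f).Adj (σ i) (σ j) := by
  have h := List.all_eq_true.1 h _ (mem_perms4 σ)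
  simp only [compare4, Bool.and_eq_true, Bool.or_eq_true, Bool.not_eq_true', ← Bool.not_eq_true,
    ← imp_iff_not_or] at h
  obtain ⟨⟨⟨⟨⟨h01, h02⟩, h03⟩, h12⟩, h13⟩, h23⟩ :=
    h ⟨⟨⟨⟨⟨hσ 0 1, hσ 0 2⟩, hσ 0 3⟩, hσ 1 2⟩, hσ 1 3⟩, hσ 2 3⟩
  exact forall_fin_four_of_symm (fun i h => absurd rfl h.ne) (fun i j h h' => (h h'.symm).symm)
    h01 h02 h03 h12 h13 h23

theorem eq_graph4 (G : SimpleGraph (Fin 4)) : ∃ a b c d e f, G = graph4 a b c d e f := by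
  classical
  refine ⟨decide (G.Adj 0 1), decide (G.Adj 0 2), decide (G.Adj 0 3), decide (G.Adj 1 2),
    decide (G.Adj 1 3), decide (G.Adj 2 3), ?_⟩
  ext i j
  fin_cases i <;> fin_cases j <;> 
    simp [graph4, table4, G.adj_comm 1 0, G.adj_comm 2 0, G.adj_comm 2 1, G.adj_comm 3 0,
      G.adj_comm 3 1, G.adj_comm 3 2]

/-- This dichotomy and the next three set the minimal graphs of a list against graphs that cannot
attain it: here for `(3, 1)` and `(1, 3)`, then for `(2, 2)`, for `(2, 1, 1)` and `(1, 1, 2)`, and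
for `(1, 2, 1)`. -/
theorem complete_or_hasCopy_diamond (G : SimpleGraph (Fin 4)) :
    HasCopy complete' G ∨ HasCopy G diamond' := by
  obtain ⟨a, b, c, d, e, f, rfl⟩ := eq_graph4 G
  have h : (copyTest (table4 true true true true true true) (table4 a b c d e f) ||
      copyTest (table4 a b c d e f) (table4 false true true true true true)) = true := by
    revert a b c d e f
    decide +kernel
  simp only [Bool.or_eq_true] at h
  exact h.imp hasCopy_of_copyTest hasCopy_of_copyTest

theorem hasCopy_cycle_or_hasCopy_paw (G : SimpleGraph (Fin 4)) :
    HasCopy cycle' G ∨ HasCopy G paw' := by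
  obtain ⟨a, b, c, d, e, f, rfl⟩ := eq_graph4 G
  have h : (copyTest (table4 true false true true false true) (table4 a b c d e f) ||
      copyTest (table4 a b c d e f) (table4 true true false true false true)) = true := by
    revert a b c d e f
    decide +kernel
  simp only [Bool.or_eq_true] at h
  exact h.imp hasCopy_of_copyTest hasCopy_of_copyTest

theorem hasCopy_or_hasCopy_path_or_claw (G : SimpleGraph (Fin 4)) :
    HasCopy cycle' G ∨ HasCopy triangle' G ∨ HasCopy G path' ∨ HasCopy G claw' := by
  obtain ⟨a, b, c, d, e, f, rfl⟩ := eq_graph4 G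
  have h : (copyTest (table4 true false true true false true) (table4 a b c d e f) ||
      copyTest (table4 true true false true false false) (table4 a b c d e f) ||
      copyTest (table4 a b c d e f) (table4 true false false true false true) ||
      copyTest (table4 a b c d e f) (table4 true true true false false false)) = true := by
    revert a b c d e f
    decide +kernel
  simp only [Bool.or_eq_true, or_assoc] at h
  exact h.imp hasCopy_of_copyTest <| .imp hasCopy_of_copyTest <|
    .imp hasCopy_of_copyTest hasCopy_of_copyTest

theorem hasCopy_or_hasCopy_path (G : SimpleGraph (Fin 4)) :
    HasCopy cycle' G ∨ HasCopy triangle' G ∨ HasCopy claw' G ∨ HasCopy G path' := by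
  obtain ⟨a, b, c, d, e, f, rfl⟩ := eq_graph4 G
  have h : (copyTest (table4 true false true true false true) (table4 a b c d e f) ||
      copyTest (table4 true true false true false false) (table4 a b c d e f) ||
      copyTest (table4 true true true false false false) (table4 a b c d e f) ||
      copyTest (table4 a b c d e f) (table4 true false false true false true)) = true := by
    revert a b c d e f
    decide +kernel
  simp only [Bool.or_eq_true, or_assoc] at h
  exact h.imp hasCopy_of_copyTest <| .imp hasCopy_of_copyTest <|
    .imp hasCopy_of_copyTest hasCopy_of_copyTest

theorem exists_adj_of_connected {V : Type*} {G : SimpleGraph V} (hG : G.Connected) {S : Set V}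
    {u v : V} (hu : u ∈ S) (hv : v ∉ S) : ∃ i ∈ S, ∃ j ∉ S, G.Adj i j := by
  obtain ⟨p⟩ := hG.preconnected u v
  obtain ⟨d, -, h1, h2⟩ := p.exists_boundary_dart S hu hv
  exact ⟨_, h1, _, h2, d.adj⟩

/-- The seven conjuncts say that an edge crosses each cut of the vertex set: four cuts isolate a
vertex and three split the vertices into pairs. A connected graph satisfies them all. -/
theorem connected_classification_aux : ∀ a b c d e f : Bool,
    ((a || b || c) && (a || d || e) && (b || d || f) && (c || e || f) && (b || c || d || e) &&
      (a || c || d || f) && (a || b || e || f)) = true →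
    (isoTest (table4 true false false true false true) (table4 a b c d e f) ||
      isoTest (table4 true true true false false false) (table4 a b c d e f) ||
      isoTest (table4 true true false true false true) (table4 a b c d e f) ||
      isoTest (table4 true false true true false true) (table4 a b c d e f) ||
      isoTest (table4 false true true true true true) (table4 a b c d e f) ||
      isoTest (table4 true true true true true true) (table4 a b c d e f)) = true := by
  decide +kernel

theorem connected_classification {G : SimpleGraph (Fin 4)} (hG : G.Connected) :
    Iso G path' ∨ Iso G claw' ∨ Iso G paw' ∨ Iso G cycle' ∨ Iso G diamond' ∨ Iso G complete' := by
  obtain ⟨a, b, c, d, e, f, rfl⟩ := eq_graph4 G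
  have key (S : Fin 4 → Bool) (u v : Fin 4) (hu : S u = true) (hv : ¬ S v = true) :
      ∃ i j, S i = true ∧ ¬ S j = true ∧ (graph4 a b c d e f).Adj i j := by
    obtain ⟨i, hi, j, hj, h⟩ := exists_adj_of_connected hG (S := {i | S i = true}) hu hv
    exact ⟨i, j, hi, hj, h⟩
  have h0 := key ![true, false, false, false] 0 1 rfl (by decide)
  have h1 := key ![false, true, false, false] 1 0 rfl (by decide)
  have h2 := key ![false, false, true, false] 2 0 rfl (by decide)
  have h3 := key ![false, false, false, true] 3 0 rfl (by decide)
  have h4 := key ![true, true, false, false] 0 2 rfl (by decide)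
  have h5 := key ![true, false, true, false] 0 1 rfl (by decide)
  have h6 := key ![true, false, false, true] 0 1 rfl (by decide)
  clear key hG
  have h := connected_classification_aux a b c d e f (by
    simp only [Bool.and_eq_true]
    exact ⟨⟨⟨⟨⟨⟨
      by revert h0; clear * -; revert a b c d e f; decide +kernel,
      by revert h1; clear * -; revert a b c d e f; decide +kernel⟩,
      by revert h2; clear * -; revert a b c d e f; decide +kernel⟩,
      by revert h3; clear * -; revert a b c d e f; decide +kernel⟩,
      by revert h4; clear * -; revert a b c d e f; decide +kernel⟩,
      by revert h5; clear * -; revert a b c d e f; decide +kernel⟩,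
      by revert h6; clear * -; revert a b c d e f; decide +kernel⟩)
  simp only [Bool.or_eq_true, or_assoc] at h
  exact h.imp iso_of_isoTest <| .imp iso_of_isoTest <| .imp iso_of_isoTest <|
    .imp iso_of_isoTest <| .imp iso_of_isoTest iso_of_isoTest

end Classification
-- Identification with the standard graphs
section Names

theorem path'_eq : path' = SimpleGraph.pathGraph 4 := by
  ext i j
  rw [SimpleGraph.pathGraph_adj]
  revert i j
  decide

theorem cycle'_eq : cycle' = SimpleGraph.cycleGraph 4 := by
  ext i j
  rw [SimpleGraph.cycleGraph_adj']
  revert i j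
  decide

theorem complete'_eq : complete' = ⊤ := by
  ext i j
  rw [SimpleGraph.top_adj]
  revert i j
  decide

theorem empty'_eq : empty' = ⊥ := by
  ext i j
  rw [SimpleGraph.bot_adj]
  revert i j
  decide

theorem paw'_eq : paw' = paw := by
  ext i j
  simp only [paw, SimpleGraph.fromEdgeSet_adj, Set.mem_insert_iff, Set.mem_singleton_iff]
  revert i j
  decide

theorem diamond'_eq : diamond' = diamond := by
  ext i j
  simp only [diamond, SimpleGraph.deleteEdges_adj, SimpleGraph.top_adj, Set.mem_singleton_iff]
  revert i j
  decide

theorem claw'_iso : Nonempty (claw' ≃g K13) := by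
  refine ⟨SimpleGraph.Iso.symm ⟨finSumFinEquiv, fun {i j} => ?_⟩⟩
  rw [completeBipartiteGraph_adj]
  revert i j
  decide

theorem triangle'_iso : Nonempty (triangle' ≃g K3K1) := by
  refine ⟨SimpleGraph.Iso.symm ⟨finSumFinEquiv, fun {i j} => ?_⟩⟩
  rcases i with i | i <;> rcases j with j | j <;> revert i j <;> simp <;> decide

theorem iso_congr {V W U : Type*} {G : SimpleGraph V} {H : SimpleGraph W} {K : SimpleGraph U}
    (h : Nonempty (H ≃g K)) : Iso G H ↔ Iso G K :=
  ⟨fun ⟨e⟩ => h.elim fun f => ⟨e.trans f⟩, fun ⟨e⟩ => h.elim fun f => ⟨e.trans f.symm⟩⟩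

end Names

/-! ### The lists attained by the connected graphs -/

section Attained

/-- Constructions with the SSP bound the attained lists from below and obstructions without it bound
them from above, so both notions of attainment give `S`. -/
theorem attained_of_iso {G H : SimpleGraph (Fin 4)} (hGH : Iso G H) {S : Set (List ℕ)}
    (hS : ∀ m ∈ S, SpectrallyArbitraryWithSSP m H) (hneg : attainedLists H ⊆ S) :
    attainedLists G = S ∧ ∀ m ∈ attainedLists G, SpectrallyArbitraryWithSSP m G := by
  obtain ⟨e⟩ := hGH
  have heq : attainedLists G = S :=
    (attainedLists_eq_of_iso e).trans
      (hneg.antisymm fun m hm => (hS m hm).attainsWithSSP.mem_attainedLists)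
  exact ⟨heq, fun m hm => (hS m (heq ▸ hm)).of_iso e.symm⟩

theorem simple_arbitrary (G : SimpleGraph (Fin 4)) : SpectrallyArbitraryWithSSP [1, 1, 1, 1] G :=
  one_one_one_one_arbitrary_empty.mono (empty'_eq ▸ bot_le)

theorem arbitrary_of_hasCopy_cycle {G : SimpleGraph (Fin 4)} (hG : HasCopy cycle' G) :
    ∀ m ∈ ({[1, 1, 1, 1], [1, 2, 1], [2, 1, 1], [1, 1, 2], [2, 2]} : Set (List ℕ)),
      SpectrallyArbitraryWithSSP m G := by
  rintro m (rfl | rfl | rfl | rfl | rfl)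
  · exact simple_arbitrary G
  · exact arbitrary_cycle.1.of_hasCopy hG
  · exact arbitrary_cycle.2.1.of_hasCopy hG
  · exact arbitrary_cycle.2.2.of_hasCopy hG
  · exact two_two_arbitrary_cycle.of_hasCopy hG

theorem arbitrary_complete :
    ∀ m ∈ ({[1, 1, 1, 1], [1, 2, 1], [2, 1, 1], [1, 1, 2], [2, 2], [3, 1], [1, 3]} :
      Set (List ℕ)), SpectrallyArbitraryWithSSP m complete' := by
  rintro m (rfl | rfl | rfl | rfl | rfl | rfl | rfl)
  · exact simple_arbitrary _
  · exact arbitrary_of_hasCopy_cycle (hasCopy_of_copyTest (by decide +kernel)) _ (by simp)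
  · exact arbitrary_of_hasCopy_cycle (hasCopy_of_copyTest (by decide +kernel)) _ (by simp)
  · exact arbitrary_of_hasCopy_cycle (hasCopy_of_copyTest (by decide +kernel)) _ (by simp)
  · exact arbitrary_of_hasCopy_cycle (hasCopy_of_copyTest (by decide +kernel)) _ (by simp)
  · exact three_one_arbitrary_complete
  · exact one_three_arbitrary_complete

theorem arbitrary_paw :
    ∀ m ∈ ({[1, 1, 1, 1], [1, 2, 1], [2, 1, 1], [1, 1, 2]} : Set (List ℕ)),
      SpectrallyArbitraryWithSSP m paw' := by
  have hc : HasCopy triangle' paw' := hasCopy_of_copyTest (by decide +kernel)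
  rintro m (rfl | rfl | rfl | rfl)
  · exact simple_arbitrary _
  · exact arbitrary_triangle.1.of_hasCopy hc
  · exact arbitrary_triangle.2.1.of_hasCopy hc
  · exact arbitrary_triangle.2.2.of_hasCopy hc

theorem arbitrary_claw :
    ∀ m ∈ ({[1, 1, 1, 1], [1, 2, 1]} : Set (List ℕ)), SpectrallyArbitraryWithSSP m claw' := by
  rintro m (rfl | rfl)
  · exact simple_arbitrary _
  · exact one_two_one_arbitrary_claw

/-- A graph with an induced path on three vertices attains no list with an entry greater than two. -/
theorem attainedLists_subset_of_induced_path {G : SimpleGraph (Fin 4)} {i j k : Fin 4}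
    (hij : G.Adj i j) (hjk : G.Adj j k) (hne : i ≠ k) (hik : ¬ G.Adj i k) :
    attainedLists G ⊆ {[1, 1, 1, 1], [1, 2, 1], [2, 1, 1], [1, 1, 2], [2, 2]} := by
  intro m hm
  have h3 := three_notMem_of_mem_attainedLists hij hjk hne hik hm
  have h4 := four_notMem_attainedLists hij
  rcases mem_of_mem_attainedLists hm with
    rfl | rfl | rfl | rfl | rfl | rfl | rfl | rfl <;> simp_all

theorem attainedLists_path_subset : attainedLists path' ⊆ {[1, 1, 1, 1]} := by
  intro m hm
  have h2 := two_notMem_of_mem_attainedLists_path hm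
  rcases attainedLists_subset_of_induced_path (i := 0) (j := 1) (k := 2) (by decide) (by decide)
    (by decide) (by decide) hm with rfl | rfl | rfl | rfl | rfl <;> simp_all

theorem attainedLists_claw_subset : attainedLists claw' ⊆ {[1, 1, 1, 1], [1, 2, 1]} := by
  intro m hm
  have h1 := two_one_one_notMem_attainedLists_claw
  have h2 := one_one_two_notMem_attainedLists_claw
  have h3 : [2, 2] ∉ attainedLists claw' :=
    two_two_notMem_attainedLists (i := 1) (j := 0) (k := 2) (by decide) (by decide) (by decide)
      (by decide) (by decide)
  rcases attainedLists_subset_of_induced_path (i := 1) (j := 0) (k := 2) (by decide) (by decide)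
    (by decide) (by decide) hm with rfl | rfl | rfl | rfl | rfl <;> simp_all

theorem attainedLists_paw_subset :
    attainedLists paw' ⊆ {[1, 1, 1, 1], [1, 2, 1], [2, 1, 1], [1, 1, 2]} := by
  intro m hm
  have h3 : [2, 2] ∉ attainedLists paw' :=
    two_two_notMem_attainedLists (i := 0) (j := 2) (k := 3) (by decide) (by decide) (by decide)
      (by decide) (by decide)
  rcases attainedLists_subset_of_induced_path (i := 0) (j := 2) (k := 3) (by decide) (by decide)
    (by decide) (by decide) hm with rfl | rfl | rfl | rfl | rfl <;> simp_all

theorem attainedLists_cycle_subset : attainedLists cycle' ⊆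
    {[1, 1, 1, 1], [1, 2, 1], [2, 1, 1], [1, 1, 2], [2, 2]} :=
  attainedLists_subset_of_induced_path (i := 0) (j := 1) (k := 2) (by decide) (by decide)
    (by decide) (by decide)

theorem attainedLists_diamond_subset : attainedLists diamond' ⊆
    {[1, 1, 1, 1], [1, 2, 1], [2, 1, 1], [1, 1, 2], [2, 2]} :=
  attainedLists_subset_of_induced_path (i := 0) (j := 2) (k := 1) (by decide) (by decide)
    (by decide) (by decide)

theorem attainedLists_complete_subset : attainedLists complete' ⊆
    {[1, 1, 1, 1], [1, 2, 1], [2, 1, 1], [1, 1, 2], [2, 2], [3, 1], [1, 3]} := by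
  intro m hm
  have h4 := four_notMem_attainedLists (G := complete') (i := 0) (j := 1) (by decide)
  rcases mem_of_mem_attainedLists hm with
    rfl | rfl | rfl | rfl | rfl | rfl | rfl | rfl <;> simp_all

end Attained

/-! ### The minimal graphs of each list -/

section Minimal

variable (G : SimpleGraph (Fin 4))

/-- Attainment with the SSP passes up to supergraphs, so impossibility passes down to subgraphs. -/
theorem not_attainsWithSSP_of_hasCopy {m : List ℕ} {G H : SimpleGraph (Fin 4)} (h : HasCopy G H)
    (hm : m ∉ attainedLists H) : ¬ AttainsWithSSP m G :=
  fun hG => hm (hG.of_hasCopy h).mem_attainedLists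

theorem isMinimalForSSP_three_one {m : List ℕ} (hm : m ∈ ({[3, 1], [1, 3]} : Set (List ℕ))) :
    IsMinimalForSSP m G ↔ Iso G complete' := by
  rw [isMinimalForSSP_iff (L := {complete'})]
  · simp
  · rintro H rfl
    exact (arbitrary_complete m (by rcases hm with rfl | rfl <;> simp)).attainsWithSSP
  · intro G hG
    refine ⟨_, rfl, (complete_or_hasCopy_diamond G).resolve_right fun h =>
      not_attainsWithSSP_of_hasCopy h (fun h' => ?_) hG⟩
    have := attainedLists_diamond_subset h'
    rcases hm with rfl | rfl <;> simp at this
  · rintro H rfl H' rfl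
    exact adj_of_antiTest (by decide +kernel)

theorem isMinimalForSSP_two_two : IsMinimalForSSP [2, 2] G ↔ Iso G cycle' := by
  rw [isMinimalForSSP_iff (L := {cycle'})]
  · simp
  · rintro H rfl
    exact two_two_arbitrary_cycle.attainsWithSSP
  · intro G hG
    refine ⟨_, rfl, (hasCopy_cycle_or_hasCopy_paw G).resolve_right fun h =>
      not_attainsWithSSP_of_hasCopy h (fun h' => ?_) hG⟩
    simpa using attainedLists_paw_subset h'
  · rintro H rfl H' rfl
    exact adj_of_antiTest (by decide +kernel)

theorem isMinimalForSSP_one_two_one :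
    IsMinimalForSSP [1, 2, 1] G ↔ Iso G cycle' ∨ Iso G triangle' ∨ Iso G claw' := by
  rw [isMinimalForSSP_iff (L := {cycle', triangle', claw'})]
  · simp
  · rintro H (rfl | rfl | rfl)
    · exact arbitrary_cycle.1.attainsWithSSP
    · exact arbitrary_triangle.1.attainsWithSSP
    · exact one_two_one_arbitrary_claw.attainsWithSSP
  · intro G hG
    rcases hasCopy_or_hasCopy_path G with h | h | h | h
    · exact ⟨_, by simp, h⟩
    · exact ⟨_, by simp, h⟩
    · exact ⟨_, by simp, h⟩
    · exact absurd hG (not_attainsWithSSP_of_hasCopy h fun h' => by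
        simpa using attainedLists_path_subset h')
  · rintro H (rfl | rfl | rfl) H' (rfl | rfl | rfl) <;>
      exact adj_of_antiTest (by decide +kernel)

theorem isMinimalForSSP_two_one_one {m : List ℕ}
    (hm : m ∈ ({[2, 1, 1], [1, 1, 2]} : Set (List ℕ))) :
    IsMinimalForSSP m G ↔ Iso G cycle' ∨ Iso G triangle' := by
  rw [isMinimalForSSP_iff (L := {cycle', triangle'})]
  · simp
  · rintro H (rfl | rfl)
    · rcases hm with rfl | rfl
      exacts [arbitrary_cycle.2.1.attainsWithSSP, arbitrary_cycle.2.2.attainsWithSSP]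
    · rcases hm with rfl | rfl
      exacts [arbitrary_triangle.2.1.attainsWithSSP, arbitrary_triangle.2.2.attainsWithSSP]
  · intro G hG
    rcases hasCopy_or_hasCopy_path_or_claw G with h | h | h | h
    · exact ⟨_, by simp, h⟩
    · exact ⟨_, by simp, h⟩
    · exact absurd hG (not_attainsWithSSP_of_hasCopy h fun h' => by
        have := attainedLists_path_subset h'
        rcases hm with rfl | rfl <;> simp at this)
    · exact absurd hG (not_attainsWithSSP_of_hasCopy h fun h' => by
        have := attainedLists_claw_subset h'
        rcases hm with rfl | rfl <;> simp at this)
  · rintro H (rfl | rfl) H' (rfl | rfl) <;>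
      exact adj_of_antiTest (by decide +kernel)

theorem isMinimalForSSP_one_one_one_one : IsMinimalForSSP [1, 1, 1, 1] G ↔ G = ⊥ := by
  have h := (simple_arbitrary (⊥ : SimpleGraph (Fin 4))).attainsWithSSP
  constructor
  · intro hG
    exact le_bot_iff.1 (hG.2 h bot_le)
  · rintro rfl
    exact ⟨h, fun _ _ _ => bot_le⟩

theorem not_attainsWithSSP_four : ¬ AttainsWithSSP [4] G := fun h => by
  have := attainedLists_complete_subset
    (h.mono (complete'_eq ▸ le_top : G ≤ complete')).mem_attainedLists
  simp at this

end Minimal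
end IEP

/-! ### The classification theorem -/

theorem mainTheorem6 :
    -- the minimal graphs with respect to the SSP, for every ordered multiplicity list of order 4
    ((∀ G : SimpleGraph (Fin 4),
      (∀ m ∈ ({[3, 1], [1, 3]} : Set (List ℕ)),
        (IEP.IsMinimalForSSP m G ↔ IEP.Iso G (⊤ : SimpleGraph (Fin 4)))) ∧
      (IEP.IsMinimalForSSP [2, 2] G ↔ IEP.Iso G (SimpleGraph.cycleGraph 4)) ∧
      (IEP.IsMinimalForSSP [1, 2, 1] G ↔
        IEP.Iso G (SimpleGraph.cycleGraph 4) ∨ IEP.Iso G IEP.K3K1 ∨ IEP.Iso G IEP.K13) ∧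
      (∀ m ∈ ({[2, 1, 1], [1, 1, 2]} : Set (List ℕ)),
        (IEP.IsMinimalForSSP m G ↔
          IEP.Iso G (SimpleGraph.cycleGraph 4) ∨ IEP.Iso G IEP.K3K1)) ∧
      (IEP.IsMinimalForSSP [1, 1, 1, 1] G ↔ G = ⊥) ∧
      ¬ IEP.IsMinimalForSSP [4] G)) ∧
    -- the ordered multiplicity lists attained by each connected graph of order 4, with or without
    -- the SSP, all of which are spectrally arbitrary with the SSP
    (∀ G : SimpleGraph (Fin 4), G.Connected →
      ((IEP.Iso G (SimpleGraph.pathGraph 4) ∧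
          IEP.attainedLists G = {[1, 1, 1, 1]}) ∨
        (IEP.Iso G IEP.K13 ∧
          IEP.attainedLists G = {[1, 1, 1, 1], [1, 2, 1]}) ∨
        (IEP.Iso G IEP.paw ∧
          IEP.attainedLists G = {[1, 1, 1, 1], [1, 2, 1], [2, 1, 1], [1, 1, 2]}) ∨
        (IEP.Iso G (SimpleGraph.cycleGraph 4) ∧
          IEP.attainedLists G = {[1, 1, 1, 1], [1, 2, 1], [2, 1, 1], [1, 1, 2], [2, 2]}) ∨
        (IEP.Iso G IEP.diamond ∧
          IEP.attainedLists G = {[1, 1, 1, 1], [1, 2, 1], [2, 1, 1], [1, 1, 2], [2, 2]}) ∨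
        (IEP.Iso G (⊤ : SimpleGraph (Fin 4)) ∧
          IEP.attainedLists G =
            {[1, 1, 1, 1], [1, 2, 1], [2, 1, 1], [1, 1, 2], [2, 2], [3, 1], [1, 3]})) ∧
      ∀ m ∈ IEP.attainedLists G, IEP.SpectrallyArbitraryWithSSP m G) := by
  have hC (G : SimpleGraph (Fin 4)) :
      IEP.Iso G IEP.cycle' ↔ IEP.Iso G (SimpleGraph.cycleGraph 4) := by rw [IEP.cycle'_eq]
  have hK (G : SimpleGraph (Fin 4)) :
      IEP.Iso G IEP.complete' ↔ IEP.Iso G (⊤ : SimpleGraph (Fin 4)) := by rw [IEP.complete'_eq]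
  have hT (G : SimpleGraph (Fin 4)) : IEP.Iso G IEP.triangle' ↔ IEP.Iso G IEP.K3K1 :=
    IEP.iso_congr IEP.triangle'_iso
  have hS (G : SimpleGraph (Fin 4)) : IEP.Iso G IEP.claw' ↔ IEP.Iso G IEP.K13 :=
    IEP.iso_congr IEP.claw'_iso
  refine ⟨fun G => ⟨fun m hm => ?_, ?_, ?_, fun m hm => ?_, IEP.isMinimalForSSP_one_one_one_one G,
    fun h => IEP.not_attainsWithSSP_four G h.1⟩, fun G hG => ?_⟩
  · rw [← hK]; exact IEP.isMinimalForSSP_three_one G hm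
  · rw [← hC]; exact IEP.isMinimalForSSP_two_two G
  · rw [← hC, ← hT, ← hS]; exact IEP.isMinimalForSSP_one_two_one G
  · rw [← hC, ← hT]; exact IEP.isMinimalForSSP_two_one_one G hm
  · rw [← hC, ← hK, ← hS, ← IEP.path'_eq, ← IEP.paw'_eq, ← IEP.diamond'_eq]
    rcases IEP.connected_classification hG with h | h | h | h | h | h
    · obtain ⟨h1, h2⟩ := IEP.attained_of_iso h (S := {[1, 1, 1, 1]})
        (by rintro m rfl; exact IEP.simple_arbitrary _) IEP.attainedLists_path_subset
      exact ⟨.inl ⟨h, h1⟩, h2⟩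
    · obtain ⟨h1, h2⟩ := IEP.attained_of_iso h IEP.arbitrary_claw IEP.attainedLists_claw_subset
      exact ⟨.inr <| .inl ⟨h, h1⟩, h2⟩
    · obtain ⟨h1, h2⟩ := IEP.attained_of_iso h IEP.arbitrary_paw IEP.attainedLists_paw_subset
      exact ⟨.inr <| .inr <| .inl ⟨h, h1⟩, h2⟩
    · obtain ⟨h1, h2⟩ := IEP.attained_of_iso h (IEP.arbitrary_of_hasCopy_cycle
        (IEP.hasCopy_of_copyTest (by decide +kernel))) IEP.attainedLists_cycle_subset
      exact ⟨.inr <| .inr <| .inr <| .inl ⟨h, h1⟩, h2⟩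
    · obtain ⟨h1, h2⟩ := IEP.attained_of_iso h (IEP.arbitrary_of_hasCopy_cycle
        (IEP.hasCopy_of_copyTest (by decide +kernel))) IEP.attainedLists_diamond_subset
      exact ⟨.inr <| .inr <| .inr <| .inr <| .inl ⟨h, h1⟩, h2⟩
    · obtain ⟨h1, h2⟩ := IEP.attained_of_iso h IEP.arbitrary_complete
        IEP.attainedLists_complete_subset
      exact ⟨.inr <| .inr <| .inr <| .inr <| .inr ⟨h, h1⟩, h2⟩
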